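/- Let $G$ be a topological group. A $G$-space is a topological space with a continuous action $G\times X\to X$, and a topological $G$-module is a topological abelian group with a continuous action of $G$ by automorphisms. The local-section site $T_G$ is the category of $G$-spaces and continuous $G$-equivariant maps, where a family $\{\pi_i: X_i\to X\}$ is a covering if every $x\in X$ has an open neighbourhood $V$ such that, for some $i$, there is a continuous (not necessarily equivariant) map $s:V\to X_i$ with $\pi_i s=\mathrm{id}_V$. For a topological $G$-module $A$ let $\tilde A$ be the sheaf $X\mapsto \mathrm{Map}_G(X,A)$ (continuous $G$-equivariant maps) on $T_G$, and let $H^i(G,A)=H^i(T_G,*,\tilde A)$ be its sheaf cohomology over the one-point $G$-space. Let $H^i_{cont}(G,A)$ be the cohomology of the complex of homogeneous continuous cochains $C^p(G,A)=\mathrm{Map}_G(G^{p+1},A)$ ($G$ acting diagonally on $G^{p+1}$) with differential $$(\delta f)(g_0,\dots,g_{p+1})=\sum_{i=0}^{p+1}(-1)^i f(g_0,\dots,\widehat{g_i},\dots,g_{p+1}).$$ **Theorem.** Let $G$ be (a) a profinite group, or (b) the Weil group of a global function field $K$, that is, of a finite extension $K$ of $\mathbb F_q(X)$: the group of pairs $(\sigma,n)\in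 \mathrm{Gal}(K^{sep}/K)\times\mathbb Z$ such that $\sigma$ acts as the $n$-th power of the Frobenius automorphism $x\mapsto x^q$ on the algebraic closure of $\mathbb F_q$ in $K^{sep}$, topologized as a subgroup of the product of $\mathrm{Gal}(K^{sep}/K)$ with its Krull topology and the discrete group $\mathbb Z$. Then $H^i(G,A)$ and $H^i_{cont}(G,A)$ are canonically isomorphic for all topological $G$-modules $A$ and all $i\ge 0$. Precisely, there are group isomorphisms $\Phi^i_A:H^i(G,A)\to H^i_{cont}(G,A)$ such that: 1. they are natural with respect to continuous $G$-homomorphisms $A\to B$; 2. for $i=0$, $\Phi^0_A$ is the evident identification of both groups with $A^G$; 3. they are compatible with connecting homomorphisms: let $A\xrightarrow{\varphi} B\xrightarrow{\psi} C$ be continuous $G$-homomorphisms such that $0\to\tilde A\to\tilde B\to\tilde C\to 0$ is a short exact sequence of sheaves on $T_G$, with connecting homomorphism $\partial:H^i(G,C)\to H^{i+1}(G,A)$. If $x \in H^i(G,C)$, $\Phi^i_C(x)$ is the class of a cocycle $c$, $b\in C^i(G,B)$ satisfies $\psi\circ b=c$, and $a\in C^{i+1}(G,A)$ is a cocycle with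 $\varphi\circ a=\delta b$, then $\Phi^{i+1}_A(\partial x)$ is the class of $a$. -/

import Mathlib

open CategoryTheory

universe u v w

/-! ### The category of `G`-spaces and its local-section topology -/

/-- A `G`-space: a topological space with a (jointly) continuous left action of the topological
group `G`. -/
structure GSpace (G : Type u) [Group G] [TopologicalSpace G] where
  carrier : Type u
  [topologicalSpace : TopologicalSpace carrier]
  [mulAction : MulAction G carrier]
  [continuousSMul : ContinuousSMul G carrier]

namespace GSpace

attribute [instance] GSpace.topologicalSpace GSpace.mulAction GSpace.continuousSMul

variable {G : Type u} [Group G] [TopologicalSpace G]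

instance : CoeSort (GSpace G) (Type u) := ⟨GSpace.carrier⟩

/-- Morphisms of `G`-spaces: continuous `G`-equivariant maps. -/
@[ext]
structure Hom (X Y : GSpace G) where
  toFun : X → Y
  continuous_toFun : Continuous toFun
  map_smul : ∀ (g : G) (x : X), toFun (g • x) = g • toFun x

instance (X Y : GSpace G) : CoeFun (Hom X Y) (fun _ => X → Y) := ⟨Hom.toFun⟩

instance : Category.{u} (GSpace G) where
  Hom X Y := Hom X Y
  id X := ⟨fun x => x, continuous_id, fun _ _ => rfl⟩
  comp f g := ⟨fun x => g.toFun (f.toFun x), g.continuous_toFun.comp f.continuous_toFun,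
    fun a x => by rw [f.map_smul, g.map_smul]⟩

/-- The underlying function of a morphism of `G`-spaces. -/
abbrev fn {X Y : GSpace G} (f : X ⟶ Y) : X → Y := Hom.toFun f

@[simp] lemma fn_id {X : GSpace G} (x : X) : fn (𝟙 X) x = x := rfl

@[simp] lemma fn_comp {X Y Z : GSpace G} (f : X ⟶ Y) (g : Y ⟶ Z) (x : X) :
    fn (f ≫ g) x = fn g (fn f x) := rfl

lemma fn_ext {X Y : GSpace G} {f g : X ⟶ Y} (h : ∀ x, fn f x = fn g x) : f = g :=
  Hom.ext (funext h)

lemma continuous_fn {X Y : GSpace G} (f : X ⟶ Y) : Continuous (fn f) := f.continuous_toFun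

lemma fn_smul {X Y : GSpace G} (f : X ⟶ Y) (a : G) (x : X) : fn f (a • x) = a • fn f x :=
  f.map_smul a x

/-- The fibre product of two `G`-spaces over a third one. -/
def fiberProduct {X Y Z : GSpace G} (f : X ⟶ Z) (g : Y ⟶ Z) : GSpace G :=
  letI : MulAction G {p : X × Y // fn f p.1 = fn g p.2} :=
    { smul := fun a p => ⟨a • p.1, by
        rw [Prod.smul_fst, Prod.smul_snd, fn_smul, fn_smul, p.2]⟩
      one_smul := fun p => Subtype.ext (one_smul G p.1)
      mul_smul := fun a b p => Subtype.ext (mul_smul a b p.1) }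
  { carrier := {p : X × Y // fn f p.1 = fn g p.2}
    continuousSMul := ⟨Continuous.subtype_mk
      (continuous_fst.smul (continuous_subtype_val.comp continuous_snd)) _⟩ }

/-- The first projection of the fibre product. -/
def fiberFst {X Y Z : GSpace G} (f : X ⟶ Z) (g : Y ⟶ Z) : fiberProduct f g ⟶ X :=
  Hom.mk (fun p => p.1.1) (continuous_fst.comp continuous_subtype_val) (fun _ _ => rfl)

/-- The second projection of the fibre product. -/
def fiberSnd {X Y Z : GSpace G} (f : X ⟶ Z) (g : Y ⟶ Z) : fiberProduct f g ⟶ Y :=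
  Hom.mk (fun p => p.1.2) (continuous_snd.comp continuous_subtype_val) (fun _ _ => rfl)

lemma fiber_comm {X Y Z : GSpace G} (f : X ⟶ Z) (g : Y ⟶ Z) :
    fiberFst f g ≫ f = fiberSnd f g ≫ g := fn_ext fun p => p.2

/-- A collection of morphisms with target `X` admits local sections if every point of `X` has an
open neighbourhood on which some member `p : Y ⟶ X` of the collection has a continuous
(not necessarily equivariant) section. -/
def AdmitsLocalSections {X : GSpace G} (R : Presieve X) : Prop :=
  ∀ x : X, ∃ V : Set X, IsOpen V ∧ x ∈ V ∧ ∃ (Y : GSpace G) (p : Y ⟶ X), R p ∧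
    ∃ s : V → Y, Continuous s ∧ ∀ v : V, fn p (s v) = v

/-- The local-section topology: a sieve is covering if and only if it admits local sections. -/
def localSectionTopology (G : Type u) [Group G] [TopologicalSpace G] :
    GrothendieckTopology (GSpace G) where
  sieves X := {S | AdmitsLocalSections S.arrows}
  top_mem' X x := ⟨Set.univ, isOpen_univ, trivial, X, 𝟙 X, trivial, Subtype.val,
    continuous_subtype_val, fun _ => rfl⟩
  pullback_stable' X Y S f hS y := by
    obtain ⟨V, hV, hx, Z, p, hp, s, hs, hsp⟩ := hS (fn f y)
    refine ⟨fn f ⁻¹' V, hV.preimage (continuous_fn f), hx, fiberProduct p f, fiberSnd p f, ?_,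
      fun v => ⟨(s ⟨fn f v.1, v.2⟩, v.1), hsp _⟩, ?_, fun _ => rfl⟩
    · change S (fiberSnd p f ≫ f)
      rw [← fiber_comm]
      exact S.downward_closed hp _
    · refine Continuous.subtype_mk (Continuous.prodMk (hs.comp ?_) continuous_subtype_val) _
      exact Continuous.subtype_mk ((continuous_fn f).comp continuous_subtype_val) _
  transitive' X S hS R h x := by
    obtain ⟨V, hV, hx, Y, p, hp, s, hs, hsp⟩ := hS x
    obtain ⟨W, hW, hy, Z, q, hq, t, ht, htq⟩ := h hp (s ⟨x, hx⟩)
    have hpre : IsOpen ((Subtype.val : V → X) '' (s ⁻¹' W)) :=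
      hV.isOpenMap_subtype_val _ (hW.preimage hs)
    have hmem : ∀ v : (Subtype.val : V → X) '' (s ⁻¹' W), ∃ h : v.1 ∈ V, s ⟨v.1, h⟩ ∈ W := by
      rintro ⟨_, v, hv, rfl⟩
      exact ⟨v.2, hv⟩
    refine ⟨_, hpre, ⟨⟨x, hx⟩, hy, rfl⟩, Z, q ≫ p, hq,
      fun v => t ⟨s ⟨v.1, (hmem v).1⟩, (hmem v).2⟩, ?_, fun v => ?_⟩
    · exact ht.comp (Continuous.subtype_mk (hs.comp
        (Continuous.subtype_mk continuous_subtype_val _)) _)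
    · rw [fn_comp, htq, hsp]

/-- The covering families of the local-section topology are those that admit local sections. -/
lemma generate_mem_localSectionTopology {X : GSpace G} (R : Presieve X) :
    Sieve.generate R ∈ localSectionTopology G X ↔ AdmitsLocalSections R := by
  constructor
  · intro h x
    obtain ⟨V, hV, hx, Y, p, ⟨Z, a, b, hb, rfl⟩, s, hs, hsp⟩ := h x
    exact ⟨V, hV, hx, Z, b, hb, fun v => fn a (s v), (continuous_fn a).comp hs, hsp⟩
  · intro h x
    obtain ⟨V, hV, hx, Y, p, hp, s, hs, hsp⟩ := h x
    exact ⟨V, hV, hx, Y, p, ⟨Y, 𝟙 Y, p, hp, Category.id_comp p⟩, s, hs, hsp⟩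

/-- The one-point `G`-space, with trivial action. -/
def point (G : Type u) [Group G] [TopologicalSpace G] : GSpace G :=
  letI : MulAction G PUnit.{u + 1} :=
    { smul := fun _ x => x, one_smul := fun _ => rfl, mul_smul := fun _ _ _ => rfl }
  { carrier := PUnit.{u + 1}
    continuousSMul := ⟨continuous_snd⟩ }

/-- The point is the final object of the category of `G`-spaces. -/
def pointIsTerminal : Limits.IsTerminal (point G) :=
  Limits.IsTerminal.ofUniqueHom
    (fun _ => Hom.mk (fun _ => PUnit.unit) continuous_const (fun _ _ => rfl))
    (fun _ _ => fn_ext fun _ => rfl)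

end GSpace

/-! ### Topological `G`-modules, the sheaves they define, and their cohomology -/

/-- A topological `G`-module: a topological abelian group with a (jointly) continuous action of
the topological group `G` by group automorphisms. -/
structure TopGModule (G : Type u) [Group G] [TopologicalSpace G] where
  carrier : Type u
  [addCommGroup : AddCommGroup carrier]
  [topologicalSpace : TopologicalSpace carrier]
  [isTopologicalAddGroup : IsTopologicalAddGroup carrier]
  [distribMulAction : DistribMulAction G carrier]
  [continuousSMul : ContinuousSMul G carrier]

namespace TopGModule

attribute [instance] TopGModule.addCommGroup TopGModule.topologicalSpace
  TopGModule.isTopologicalAddGroup TopGModule.distribMulAction TopGModule.continuousSMul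

variable {G : Type u} [Group G] [TopologicalSpace G]

instance : CoeSort (TopGModule G) (Type u) := ⟨TopGModule.carrier⟩

/-- Morphisms of topological `G`-modules: continuous `G`-equivariant homomorphisms. -/
structure Hom (A B : TopGModule G) extends A →+[G] B where
  continuous_toFun : Continuous toFun

instance (A B : TopGModule G) : CoeFun (Hom A B) (fun _ => A → B) := ⟨fun f => f.toFun⟩

/-- The group `Map_G(X, A)` of continuous equivariant maps from a space `X` with an action of `G`
to a topological `G`-module `A`, under pointwise addition. -/
def equivariantMaps (X : Type u) [TopologicalSpace X] [MulAction G X] (A : TopGModule G) :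
    AddSubgroup C(X, A) where
  carrier := {f | ∀ (g : G) (x : X), f (g • x) = g • f x}
  zero_mem' g x := by simp
  add_mem' hf hf' g x := by simp [hf g x, hf' g x]
  neg_mem' hf g x := by simp [hf g x]

lemma smul_mem (A : TopGModule G) {X : Type u} [TopologicalSpace X] [MulAction G X]
    (f : equivariantMaps X A) (g : G) (x : X) : f.1 (g • x) = g • f.1 x := f.2 g x

/-- Precomposition `Map_G(Y, A) → Map_G(X, A)` with a morphism of `G`-spaces `X → Y`. -/
def pullback (A : TopGModule G) {X Y : GSpace G} (p : X ⟶ Y) :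
    equivariantMaps Y A →+ equivariantMaps X A where
  toFun f := ⟨f.1.comp ⟨GSpace.fn p, GSpace.continuous_fn p⟩, fun g x => by
    simp [GSpace.fn_smul, smul_mem]⟩
  map_zero' := rfl
  map_add' _ _ := rfl

/-- Postcomposition `Map_G(X, A) → Map_G(X, B)` with a morphism of topological `G`-modules. -/
def postcomp {A B : TopGModule G} (φ : Hom A B) (X : Type u) [TopologicalSpace X]
    [MulAction G X] : equivariantMaps X A →+ equivariantMaps X B where
  toFun f := ⟨⟨fun x => φ (f.1 x), φ.continuous_toFun.comp f.1.continuous⟩, fun g x => by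
    change φ.toDistribMulActionHom (f.1 (g • x)) = g • φ.toDistribMulActionHom (f.1 x)
    rw [smul_mem, map_smul]⟩
  map_zero' := Subtype.ext (ContinuousMap.ext fun _ => map_zero φ.toDistribMulActionHom)
  map_add' f g := Subtype.ext (ContinuousMap.ext fun x =>
    map_add φ.toDistribMulActionHom (f.1 x) (g.1 x))

/-- The presheaf `X ↦ Map_G(X, A)` of abelian groups on the category of `G`-spaces. It is lifted
to the universe of the (large) category of `G`-spaces, where sheafification is available. -/
def presheaf (A : TopGModule G) : (GSpace G)ᵒᵖ ⥤ AddCommGrpCat.{u + 1} where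
  obj X := AddCommGrpCat.of (ULift.{u + 1} (equivariantMaps X.unop A))
  map p := AddCommGrpCat.ofHom
    (AddEquiv.ulift.symm.toAddMonoidHom.comp
      ((A.pullback p.unop).comp AddEquiv.ulift.toAddMonoidHom))
  map_id _ := rfl
  map_comp _ _ := rfl

/-- The presheaf `X ↦ Map_G(X, A)` is a sheaf for the local-section topology. -/
theorem isSheaf_presheaf (A : TopGModule G) :
    Presheaf.IsSheaf (GSpace.localSectionTopology G) A.presheaf := by
  rw [Presheaf.isSheaf_iff_isSheaf_forget (GSpace.localSectionTopology G) A.presheaf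
    (CategoryTheory.forget AddCommGrpCat.{u + 1}), isSheaf_iff_isSheaf_of_type]
  intro X S hS x hx
  let φ : ∀ ⦃Y : GSpace G⦄ (p : Y ⟶ X), S p → equivariantMaps Y A := fun Y p hp => (x p hp).down
  have hφ : ∀ ⦃Y Z : GSpace G⦄ (p : Y ⟶ X) (q : Z ⟶ X) (hp : S p) (hq : S q) (y : Y) (z : Z),
      GSpace.fn p y = GSpace.fn q z → (φ p hp).1 y = (φ q hq).1 z := by
    intro Y Z p q hp hq y z hyz
    have h := hx (GSpace.fiberFst p q) (GSpace.fiberSnd p q) hp hq (GSpace.fiber_comm p q)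
    have h2 := congrArg (fun t : ULift.{u + 1} (equivariantMaps (GSpace.fiberProduct p q) A) =>
      t.down.1 ⟨(y, z), hyz⟩) h
    exact h2
  choose V hV hxV Y p hp s hs hsp using hS
  let F : X → A := fun a => (φ (p a) (hp a)).1 (s a ⟨a, hxV a⟩)
  have hF : ∀ ⦃Z : GSpace G⦄ (q : Z ⟶ X) (hq : S q) (z : Z), F (GSpace.fn q z) = (φ q hq).1 z :=
    fun Z q hq z => hφ _ _ _ _ _ _ (hsp _ _)
  have hcont : Continuous F := by
    rw [continuous_iff_continuousAt]
    intro a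
    have h : ContinuousOn F (V a) := by
      rw [continuousOn_iff_continuous_domRestrict]
      have : (V a).domRestrict F = fun v => (φ (p a) (hp a)).1 (s a v) := by
        funext v
        change F v.1 = _
        rw [← hsp a v, hF _ (hp a)]
      rw [this]
      exact (φ (p a) (hp a)).1.continuous.comp (hs a)
    exact h.continuousAt ((hV a).mem_nhds (hxV a))
  have hequiv : ∀ (g : G) (a : X), F (g • a) = g • F a := by
    intro g a
    have h1 : GSpace.fn (p a) (s a ⟨a, hxV a⟩) = a := hsp a ⟨a, hxV a⟩
    have h2 : F (g • a) = F (GSpace.fn (p a) (g • s a ⟨a, hxV a⟩)) := by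
      rw [GSpace.fn_smul, h1]
    rw [h2, hF _ (hp a), smul_mem]
  refine ⟨ULift.up ⟨⟨F, hcont⟩, hequiv⟩, ?_, ?_⟩
  · intro Z q hq
    apply ULift.ext
    exact Subtype.ext (ContinuousMap.ext fun z => hF q hq z)
  · intro t ht
    apply ULift.ext
    refine Subtype.ext (ContinuousMap.ext fun a => ?_)
    have h := ht (p a) (hp a)
    have h2 := congrArg (fun t : ULift.{u + 1} (equivariantMaps (Y a) A) =>
      t.down.1 (s a ⟨a, hxV a⟩)) h
    have h3 : (ULift.down t : equivariantMaps X A).1 (GSpace.fn (p a) (s a ⟨a, hxV a⟩)) =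
      (φ (p a) (hp a)).1 (s a ⟨a, hxV a⟩) := h2
    rw [hsp] at h3
    exact h3

/-- The sheaf `X ↦ Map_G(X, A)` on the local-section site defined by a topological
`G`-module `A`. -/
def sheaf (A : TopGModule G) : Sheaf (GSpace.localSectionTopology G) AddCommGrpCat.{u + 1} :=
  ⟨A.presheaf, A.isSheaf_presheaf⟩

/-- Abelian sheaves on the local-section site form a Grothendieck abelian category. -/
instance : IsGrothendieckAbelian.{u + 1}
    (Sheaf (GSpace.localSectionTopology G) AddCommGrpCat.{u + 1}) := by
  have : EssentiallySmall.{u + 1} (GSpace G) := inferInstance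
  exact Sheaf.isGrothendieckAbelian_of_essentiallySmall (GSpace.localSectionTopology G)
    AddCommGrpCat.{u + 1}

/-- The morphism of sheaves induced by a morphism of topological `G`-modules. -/
def sheafMap {A B : TopGModule G} (φ : Hom A B) : A.sheaf ⟶ B.sheaf :=
  ⟨{ app := fun X => AddCommGrpCat.ofHom
      (AddEquiv.ulift.symm.toAddMonoidHom.comp
        ((postcomp φ X.unop).comp AddEquiv.ulift.toAddMonoidHom)) }⟩

/-- The cohomology group `H^n(G, A)`: the cohomology in degree `n`, over the final object, of the
sheaf `X ↦ Map_G(X, A)` on the local-section site. -/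
abbrev siteCohomology (A : TopGModule G) (n : ℕ) : Type (u + 1) := Sheaf.H.{u + 1} A.sheaf n

/-- The homomorphism `H^n(G, A) → H^n(G, B)` induced by a morphism of topological `G`-modules. -/
noncomputable def siteCohomologyMap {A B : TopGModule G} (φ : Hom A B) (n : ℕ) :
    A.siteCohomology n →+ B.siteCohomology n := Sheaf.H.map (sheafMap φ) n

/-- The element of `Map_G(point, A)`, regarded as an element of `A`, that corresponds to a
cohomology class in degree zero. -/
noncomputable def siteCohomologyZeroValue (A : TopGModule G) (x : A.siteCohomology 0) : A :=
  (ULift.down (Sheaf.H.equiv₀ A.sheaf GSpace.pointIsTerminal x) :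
    equivariantMaps (GSpace.point G) A).1 PUnit.unit

/-! ### Continuous cochain cohomology -/

/-- Homogeneous continuous `n`-cochains: continuous maps `G^(n+1) → A` that are equivariant for
the diagonal action of `G` by left translation. -/
abbrev cochains (A : TopGModule G) (n : ℕ) : AddSubgroup C(Fin (n + 1) → G, A) :=
  equivariantMaps (Fin (n + 1) → G) A

/-- The differential
`(d f)(g₀, …, g_{n+1}) = ∑ i, (-1) ^ i • f (g₀, …, omit g_i, …, g_{n+1})`. -/
def d (A : TopGModule G) (n : ℕ) : A.cochains n →+ A.cochains (n + 1) where
  toFun f := ⟨⟨fun x => ∑ i : Fin (n + 2), (-1 : ℤ) ^ (i : ℕ) • f.1 (fun j => x (i.succAbove j)),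
    by fun_prop⟩, fun g x => by
      change ∑ i : Fin (n + 2), (-1 : ℤ) ^ (i : ℕ) • f.1 (g • fun j => x (i.succAbove j)) =
        g • ∑ i : Fin (n + 2), (-1 : ℤ) ^ (i : ℕ) • f.1 (fun j => x (i.succAbove j))
      simp only [smul_mem, Finset.smul_sum]
      exact Finset.sum_congr rfl fun i _ => (smul_comm _ _ _)⟩
  map_zero' := Subtype.ext (ContinuousMap.ext fun x => by simp)
  map_add' f g := Subtype.ext (ContinuousMap.ext fun x => by
    simp [Finset.sum_add_distrib])

@[simp] lemma d_apply (A : TopGModule G) (n : ℕ) (f : A.cochains n) (x : Fin (n + 2) → G) :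
    (A.d n f).1 x =
      ∑ i : Fin (n + 2), (-1 : ℤ) ^ (i : ℕ) • f.1 (fun j => x (i.succAbove j)) := rfl

/-- The homogeneous continuous cochains form a complex. -/
theorem d_d (A : TopGModule G) (n : ℕ) (f : A.cochains n) : A.d (n + 1) (A.d n f) = 0 := by
  refine Subtype.ext (ContinuousMap.ext fun x => ?_)
  simp only [d_apply, Finset.smul_sum, smul_smul, ← pow_add]
  rw [← Finset.sum_product', Finset.univ_product_univ]
  have hsign : ∀ (i : Fin (n + 3)) (j : Fin (n + 2)),
      (-1 : ℤ) ^ ((i : ℕ) + j) + (-1 : ℤ) ^ ((i.succAbove j : ℕ) + (j.predAbove i : ℕ)) = 0 := by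
    intro i j
    rw [Fin.neg_one_pow_succAbove_add_predAbove, add_neg_cancel]
  refine Finset.sum_involution (fun p _ => (p.1.succAbove p.2, p.2.predAbove p.1)) ?_ ?_ ?_ ?_
  · rintro ⟨i, j⟩ -
    simp only [Fin.succAbove_succAbove_succAbove_predAbove]
    rw [← add_smul, hsign, zero_smul]
  · rintro ⟨i, j⟩ - - h
    exact Fin.succAbove_ne i j (congrArg Prod.fst h)
  · simp
  · rintro ⟨i, j⟩ -
    simp only [Fin.succAbove_succAbove_predAbove, Fin.predAbove_predAbove_succAbove]

/-- The continuous `n`-cocycles. -/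
def cocycles (A : TopGModule G) (n : ℕ) : AddSubgroup (A.cochains n) := (A.d n).ker

/-- The continuous `n`-coboundaries. -/
def coboundaries (A : TopGModule G) : (n : ℕ) → AddSubgroup (A.cochains n)
  | 0 => ⊥
  | n + 1 => (A.d n).range

/-- The continuous cochain cohomology group `H^n_cont(G, A)`. -/
abbrev contCohomology (A : TopGModule G) (n : ℕ) : Type u :=
  A.cocycles n ⧸ (A.coboundaries n).addSubgroupOf (A.cocycles n)

/-- The class in `H^n_cont(G, A)` of a continuous cocycle. -/
def contClass (A : TopGModule G) (n : ℕ) : A.cocycles n →+ A.contCohomology n :=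
  QuotientAddGroup.mk' _

lemma d_postcomp {A B : TopGModule G} (φ : Hom A B) (n : ℕ) (f : A.cochains n) :
    B.d n (postcomp φ _ f) = postcomp φ _ (A.d n f) := by
  refine Subtype.ext (ContinuousMap.ext fun x => ?_)
  change ∑ i : Fin (n + 2), (-1 : ℤ) ^ (i : ℕ) •
      φ.toDistribMulActionHom (f.1 (fun j => x (i.succAbove j))) =
    φ.toDistribMulActionHom (∑ i : Fin (n + 2), (-1 : ℤ) ^ (i : ℕ) •
      f.1 (fun j => x (i.succAbove j)))
  simp only [map_sum, map_zsmul]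

/-- The homomorphism on continuous cocycles induced by a morphism of topological `G`-modules. -/
def cocyclesMap {A B : TopGModule G} (φ : Hom A B) (n : ℕ) : A.cocycles n →+ B.cocycles n :=
  ((postcomp φ _).comp (A.cocycles n).subtype).codRestrict (B.cocycles n) fun z => by
    change B.d n (postcomp φ _ z.1) = 0
    rw [d_postcomp, show A.d n z.1 = 0 from z.2, map_zero]

/-- The homomorphism `H^n_cont(G, A) → H^n_cont(G, B)` induced by a morphism of topological
`G`-modules. -/
def contCohomologyMap {A B : TopGModule G} (φ : Hom A B) (n : ℕ) :
    A.contCohomology n →+ B.contCohomology n :=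
  QuotientAddGroup.map _ _ (cocyclesMap φ n) (by
    intro z hz
    rw [AddSubgroup.mem_comap, AddSubgroup.mem_addSubgroupOf]
    rw [AddSubgroup.mem_addSubgroupOf] at hz
    cases n with
    | zero =>
      have h : z.1 = 0 := hz
      change postcomp φ _ z.1 = 0
      rw [h, map_zero]
    | succ n =>
      obtain ⟨y, hy⟩ := hz
      refine ⟨postcomp φ _ y, ?_⟩
      rw [d_postcomp, hy]
      rfl)

end TopGModule

/-- A canonical isomorphism between the cohomology groups `H^n(G, A)` of the local-section site and
the continuous cochain cohomology groups `H^n_cont(G, A)`, for all topological `G`-modules `A`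
and all `n`. It is natural in `A`, is the evident identification (with the invariant elements
of `A`) in degree zero, and is compatible with the connecting homomorphisms: the one on the site is
composition with the class of a short exact sequence of sheaves, and the one on cochain cohomology
sends the class of `c` to the class of `a` if `c` lifts to a cochain `b` with `d b = φ ∘ a`. -/
structure CanonicalComparison (G : Type u) [Group G] [TopologicalSpace G] where
  /-- The isomorphisms. -/
  iso (A : TopGModule G) (n : ℕ) : A.siteCohomology n ≃+ A.contCohomology n
  natural {A B : TopGModule G} (φ : TopGModule.Hom A B) (n : ℕ) (x : A.siteCohomology n) :
    iso B n (TopGModule.siteCohomologyMap φ n x) = TopGModule.contCohomologyMap φ n (iso A n x)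
  iso_zero (A : TopGModule G) (x : A.siteCohomology 0) (z : A.cocycles 0) :
    iso A 0 x = A.contClass 0 z ↔ ∀ g : Fin 1 → G, z.1.1 g = A.siteCohomologyZeroValue x
  connecting {A B C : TopGModule G} (φ : TopGModule.Hom A B) (ψ : TopGModule.Hom B C)
    (w : TopGModule.sheafMap φ ≫ TopGModule.sheafMap ψ = 0)
    (hS : (ShortComplex.mk (TopGModule.sheafMap φ) (TopGModule.sheafMap ψ) w).ShortExact)
    (n : ℕ) (x : C.siteCohomology n) (c : C.cocycles n) (b : B.cochains n)
    (a : A.cocycles (n + 1)) (hx : iso C n x = C.contClass n c)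
    (hb : TopGModule.postcomp ψ _ b = c.1) (ha : TopGModule.postcomp φ _ a.1 = B.d n b) :
    iso A (n + 1) (Abelian.Ext.comp x hS.extClass rfl) = A.contClass (n + 1) a

/-! ### The Weil group of a global function field -/

/-- The Weil group of a global function field `K`, where `K` is a finite extension of `𝔽_q(X)` and
`Ks` is a separable closure of `K`: the fibre product of `Gal(Ks/K)` and `ℤ` over the absolute
Galois group of `𝔽_q`. Its elements are the pairs `(σ, n)` such that `σ` acts on the algebraic
closure of `𝔽_q` in `Ks` as the `n`-th power of the Frobenius automorphism `x ↦ x ^ q`. Its topology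
is the one induced by the product of the Krull topology and the discrete topology. (As
`n` is determined by `σ`, this is the group of all `σ` that act as an integral power of Frobenius,
topologized so that the kernel of `(σ, n) ↦ n`, with its profinite topology, is an open subgroup.
It does not change if `𝔽_q` is replaced by a larger finite subfield of `K`.) -/
def functionFieldWeilGroup (Fq K Ks : Type*) [Field Fq] [Fintype Fq] [Field K] [Field Ks]
    [Algebra K Ks] [Algebra Fq Ks] : Subgroup (Gal(Ks/K) × Multiplicative ℤ) where
  carrier := {w | ∀ x : algebraicClosure Fq Ks, w.1 (x : Ks) =
    ((FiniteField.frobeniusAlgEquivOfAlgebraic Fq (algebraicClosure Fq Ks) ^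
      Multiplicative.toAdd w.2) x : algebraicClosure Fq Ks)}
  one_mem' x := rfl
  mul_mem' {v w} hv hw x := by
    rw [Prod.snd_mul, toAdd_mul, zpow_add, Prod.fst_mul, AlgEquiv.mul_apply, hw, hv]
    rfl
  inv_mem' {w} hw x := by
    rw [Prod.snd_inv, toAdd_inv, Prod.fst_inv, zpow_neg]
    apply w.1.injective
    rw [hw, ← AlgEquiv.mul_apply, ← AlgEquiv.mul_apply, mul_inv_cancel, mul_inv_cancel]
    rfl

/-!
The reason for the comparison is that, for the groups in question, the Čech nerve of the covering
`G ⟶ point` provides a *projective* resolution of the constant sheaf on the local-section site.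

The free abelian sheaf `ℤ[Y]` on a `G`-space `Y` corepresents the functor `F ↦ F Y`
(`freeHomAddEquiv`), so it is projective as soon as epimorphisms of sheaves are surjective on
sections over `Y`. For `Y = G ^ (n + 1)` this holds: after splitting off the zeroth coordinate,
`Y` is `G × G ^ n` with `G` acting on the first factor only, so a covering of `Y` amounts to an open
covering of the space `G ^ n`, over whose members the local sections extend equivariantly. If `G` is
a disjoint union of profinite spaces (a profinite group, or a Weil group with its projection
to `ℤ`), every open covering of `G ^ n` is refined by a partition into open subsets. Hence every
covering of `Y` is refined by a decomposition of `Y` into open `G`-stable pieces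
(`exists_fiber_mem_of_power`), and a sheaf turns such a decomposition into a product
(`exists_glue_fiber`); local lifts of a section therefore glue without any condition.

The complex `⋯ ⟶ ℤ[G ^ 2] ⟶ ℤ[G] ⟶ ℤ ⟶ 0` is exact for every topological group `G`. For
exactness in positive degree, it suffices that Čech cocycles with values in a sheaf `F` become
coboundaries in some sheaf that contains `F`; the sheaf `T ↦ F (T × G)` does this, since the extra
coordinate is a contracting homotopy (`exists_cechD_coind`). In degree zero, exactness is the sheaf
property for `G ⟶ point` (`exists_res_toPoint_eq`).

Thus `Ext^n(ℤ, F)` is the `n`-th cohomology of the Čech complex `F (G ^ (• + 1))`, and for the sheaf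
of a topological `G`-module that is the complex of homogeneous continuous cochains. The isomorphism
is defined through the syzygies of the resolution (`SyzygyResolution.ofCocycle`): a cocycle
`f : P n ⟶ F` is a morphism from the `n`-th syzygy to `F`, and it is composed with the
iterated extension of `ℤ` by that syzygy. With this definition the compatibility with connecting
homomorphisms holds without signs, as it is the naturality of the class of an extension with respect
to the morphism of short exact sequences given by a lift of the cocycle
(`SyzygyResolution.ofCocycle_comp_extClass`).
-/

/-! ### Ext groups from a projective resolution -/

open Limits Abelian in
/-- A projective resolution `⋯ ⟶ P 1 ⟶ P 0` of the object `X`. Exactness is encoded by the cokernels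
of the differentials (the syzygies): the map `coker (d (n + 1)) ⟶ P n` is a monomorphism,
and `X` is identified with `coker (d 0)`. -/
structure SyzygyResolution {C : Type u} [Category.{v} C] [Abelian C] (X : C) where
  P : ℕ → C
  d (n : ℕ) : P (n + 1) ⟶ P n
  d_comp_d (n : ℕ) : d (n + 1) ≫ d n = 0
  projective (n : ℕ) : Projective (P n)
  mono_desc (n : ℕ) : Mono (cokernel.desc (d (n + 1)) (d n) (d_comp_d n))
  aug : X ≅ cokernel (d 0)

namespace SyzygyResolution

open Limits Abelian

variable {C : Type u} [Category.{v} C] [Abelian C] {X : C} (R : SyzygyResolution X)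

attribute [instance] projective

/-- The `n`-th syzygy, written as a quotient of `P n`. -/
noncomputable def syz (n : ℕ) : C := cokernel (R.d n)

/-- The projection of `P n` onto the `n`-th syzygy. -/
noncomputable def toSyz (n : ℕ) : R.P n ⟶ R.syz n := cokernel.π (R.d n)

instance (n : ℕ) : Epi (R.toSyz n) := inferInstanceAs (Epi (cokernel.π (R.d n)))

/-- The map out of the syzygy defined by a cocycle. -/
noncomputable def descSyz {n : ℕ} {F : C} (f : R.P n ⟶ F) (hf : R.d n ≫ f = 0) : R.syz n ⟶ F :=
  cokernel.desc (R.d n) f hf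

@[simp]
lemma toSyz_descSyz {n : ℕ} {F : C} (f : R.P n ⟶ F) (hf : R.d n ≫ f = 0) :
    R.toSyz n ≫ R.descSyz f hf = f := cokernel.π_desc _ _ _

@[simp]
lemma toSyz_descSyz_assoc {n : ℕ} {F F' : C} (f : R.P n ⟶ F) (hf : R.d n ≫ f = 0) (φ : F ⟶ F') :
    R.toSyz n ≫ R.descSyz f hf ≫ φ = f ≫ φ := by
  rw [← Category.assoc, toSyz_descSyz]

@[simp]
lemma d_toSyz (n : ℕ) : R.d n ≫ R.toSyz n = 0 := cokernel.condition _

/-- The inclusion of the `n + 1`-st syzygy into `P n`. -/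
noncomputable def fromSyz (n : ℕ) : R.syz (n + 1) ⟶ R.P n := R.descSyz (R.d n) (R.d_comp_d n)

instance (n : ℕ) : Mono (R.fromSyz n) := R.mono_desc n

@[simp]
lemma toSyz_fromSyz (n : ℕ) : R.toSyz (n + 1) ≫ R.fromSyz n = R.d n := R.toSyz_descSyz _ _

@[simp]
lemma toSyz_fromSyz_assoc (n : ℕ) {F : C} (φ : R.P n ⟶ F) :
    R.toSyz (n + 1) ≫ R.fromSyz n ≫ φ = R.d n ≫ φ := R.toSyz_descSyz_assoc _ _ _

/-- The short exact sequence `0 ⟶ syz (n + 1) ⟶ P n ⟶ syz n ⟶ 0`. -/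
noncomputable abbrev syzSeq (n : ℕ) : ShortComplex C :=
  ShortComplex.mk (R.fromSyz n) (R.toSyz n) (by
    rw [← cancel_epi (R.toSyz (n + 1)), toSyz_fromSyz_assoc, d_toSyz, comp_zero])

lemma syzSeq_shortExact (n : ℕ) : (R.syzSeq n).ShortExact where
  exact := by
    let T : ShortComplex C := ShortComplex.mk (R.d n) (R.toSyz n) (R.d_toSyz n)
    let φ : T ⟶ R.syzSeq n :=
      { τ₁ := R.toSyz (n + 1)
        τ₂ := 𝟙 _
        τ₃ := 𝟙 _
        comm₁₂ := by simp [T, syzSeq]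
        comm₂₃ := by simp [T, syzSeq] }
    have : Epi φ.τ₁ := inferInstanceAs (Epi (R.toSyz (n + 1)))
    have : IsIso φ.τ₂ := inferInstanceAs (IsIso (𝟙 _))
    have : Mono φ.τ₃ := inferInstanceAs (Mono (𝟙 _))
    rw [← ShortComplex.exact_iff_of_epi_of_isIso_of_mono φ]
    exact ShortComplex.exact_of_g_is_cokernel _ (cokernelIsCokernel (R.d n))
  mono_f := inferInstanceAs (Mono (R.fromSyz n))
  epi_g := inferInstanceAs (Epi (R.toSyz n))

variable [HasExt.{w} C]

/-- The identification of `X` with the zeroth syzygy. -/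
noncomputable def augIso : X ≅ R.syz 0 := R.aug

/-- The iterated extension of `X` by its `n`-th syzygy. -/
noncomputable def syzClass : (n : ℕ) → Ext.{w} X (R.syz n) n
  | 0 => Ext.mk₀ R.augIso.hom
  | n + 1 => (syzClass n).comp (R.syzSeq_shortExact n).extClass rfl

/-- Dimension shifting along one syzygy sequence. -/
lemma extClass_comp_bijective (n : ℕ) (F : C) (k : ℕ) {m : ℕ} (h : 1 + (k + 1) = m) :
    Function.Bijective (fun z : Ext.{w} (R.syz (n + 1)) F (k + 1) =>
      ((R.syzSeq_shortExact n).extClass.comp z h : Ext.{w} (R.syz n) F m)) := by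
  obtain rfl : k + 2 = m := by lia
  have hP : ∀ (j : ℕ) (x : Ext.{w} (R.P n) F (j + 1)), x = 0 :=
    fun j x => Ext.eq_zero_of_projective x
  constructor
  · intro x y hxy
    rw [← sub_eq_zero]
    obtain ⟨t, ht⟩ := Ext.contravariant_sequence_exact₁ (R.syzSeq_shortExact n) F (x - y) h (by
      have := sub_eq_zero.2 hxy
      rw [sub_eq_add_neg, Ext.comp_add, Ext.comp_neg, ← sub_eq_add_neg]
      exact this)
    rw [← ht]
    rw [show t = 0 from hP _ _, Ext.comp_zero]
  · intro y
    obtain ⟨t, ht⟩ := Ext.contravariant_sequence_exact₃ (R.syzSeq_shortExact n) F y (hP _ _) h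
    exact ⟨t, ht⟩

/-- Dimension shifting down to the `n`-th syzygy. -/
lemma syzClass_comp_bijective (F : C) (n k : ℕ) {m : ℕ} (h : n + (k + 1) = m) :
    Function.Bijective (fun z : Ext.{w} (R.syz n) F (k + 1) =>
      ((R.syzClass n).comp z h : Ext.{w} X F m)) := by
  induction n generalizing k m with
  | zero =>
    obtain rfl : k + 1 = m := by rw [← h, Nat.zero_add]
    refine Function.bijective_iff_has_inverse.2
      ⟨fun y => (Ext.mk₀ R.augIso.inv).comp y (zero_add _), fun z => ?_, fun z => ?_⟩
    · change (Ext.mk₀ R.augIso.inv).comp ((Ext.mk₀ R.augIso.hom).comp z (zero_add _))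
        (zero_add _) = z
      rw [Ext.mk₀_comp_mk₀_assoc, R.augIso.inv_hom_id, Ext.mk₀_id_comp]
    · change (Ext.mk₀ R.augIso.hom).comp ((Ext.mk₀ R.augIso.inv).comp z (zero_add _)) (zero_add _) = z
      rw [Ext.mk₀_comp_mk₀_assoc, R.augIso.hom_inv_id, Ext.mk₀_id_comp]
  | succ n ih =>
    have h1 := (ih (k + 1) (m := m) (by lia)).comp
      (R.extClass_comp_bijective n F k (m := k + 1 + 1) (by lia))
    convert h1 using 1
    funext z
    exact Ext.comp_assoc _ _ _ rfl (by lia) (by lia)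

/-- The Ext class represented by a cocycle `f : P n ⟶ F`. -/
noncomputable def ofCocycle {n : ℕ} {F : C} (f : R.P n ⟶ F) (hf : R.d n ≫ f = 0) :
    Ext.{w} X F n :=
  (R.syzClass n).comp (Ext.mk₀ (R.descSyz f hf)) (add_zero n)

lemma ofCocycle_add {n : ℕ} {F : C} (f g : R.P n ⟶ F) (hf : R.d n ≫ f = 0)
    (hg : R.d n ≫ g = 0) :
    R.ofCocycle (f + g) (by rw [Preadditive.comp_add, hf, hg, add_zero]) =
      R.ofCocycle f hf + R.ofCocycle g hg := by
  have : R.descSyz (f + g) (by rw [Preadditive.comp_add, hf, hg, add_zero]) =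
      R.descSyz f hf + R.descSyz g hg := by
    simp [← cancel_epi (R.toSyz n)]
  rw [ofCocycle, this, Ext.mk₀_add, Ext.comp_add]
  rfl

lemma ofCocycle_zero_eq {F : C} (f : R.P 0 ⟶ F) (hf : R.d 0 ≫ f = 0) :
    R.ofCocycle f hf = Ext.mk₀ (R.augIso.hom ≫ R.descSyz f hf) :=
  Ext.mk₀_comp_mk₀ _ _

lemma mk₀_eq_ofCocycle_iff {F : C} (φ : X ⟶ F) (f : R.P 0 ⟶ F) (hf : R.d 0 ≫ f = 0) :
    (Ext.mk₀ φ : Ext.{w} X F 0) = R.ofCocycle f hf ↔ R.toSyz 0 ≫ R.augIso.inv ≫ φ = f := by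
  rw [ofCocycle_zero_eq, (Ext.mk₀_bijective X F).1.eq_iff, ← Iso.inv_comp_eq,
    ← cancel_epi (R.toSyz 0), toSyz_descSyz]

lemma ofCocycle_surjective {n : ℕ} {F : C} (y : Ext.{w} X F n) :
    ∃ (f : R.P n ⟶ F) (hf : R.d n ≫ f = 0), R.ofCocycle f hf = y := by
  have key : ∃ g : R.syz n ⟶ F, (R.syzClass n).comp (Ext.mk₀ g) (add_zero n) = y := by
    cases n with
    | zero =>
      obtain ⟨y, rfl⟩ := (Ext.mk₀_bijective X F).2 y
      refine ⟨R.augIso.inv ≫ y, ?_⟩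
      simp only [syzClass]
      rw [Ext.mk₀_comp_mk₀, Iso.hom_inv_id_assoc]
    | succ n =>
      obtain ⟨z, rfl⟩ := (R.syzClass_comp_bijective F n 0 rfl).2 y
      obtain ⟨t, rfl⟩ := Ext.contravariant_sequence_exact₃ (R.syzSeq_shortExact n) F z
        (Ext.eq_zero_of_projective (P := R.P n) _) (add_zero 1)
      obtain ⟨g, rfl⟩ := (Ext.mk₀_bijective _ F).2 t
      refine ⟨g, ?_⟩
      simp only [syzClass]
      exact Ext.comp_assoc _ _ _ rfl rfl (by lia)
  obtain ⟨g, hg⟩ := key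
  refine ⟨R.toSyz n ≫ g, by rw [← Category.assoc, d_toSyz, zero_comp], ?_⟩
  rw [ofCocycle, ← hg]
  congr 2
  rw [← cancel_epi (R.toSyz n), toSyz_descSyz]

lemma ofCocycle_zero_eq_zero_iff {F : C} (f : R.P 0 ⟶ F) (hf : R.d 0 ≫ f = 0) :
    (R.ofCocycle f hf : Ext.{w} X F _) = 0 ↔ f = 0 := by
  rw [eq_comm, ← Ext.mk₀_zero, mk₀_eq_ofCocycle_iff, comp_zero, comp_zero, eq_comm]

lemma ofCocycle_succ_eq_zero_iff {n : ℕ} {F : C} (f : R.P (n + 1) ⟶ F)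
    (hf : R.d (n + 1) ≫ f = 0) :
    (R.ofCocycle f hf : Ext.{w} X F _) = 0 ↔ ∃ g : R.P n ⟶ F, R.d n ≫ g = f := by
  have h1 : (R.ofCocycle f hf : Ext.{w} X F _) = (R.syzClass n).comp
      ((R.syzSeq_shortExact n).extClass.comp (Ext.mk₀ (R.descSyz f hf)) (add_zero 1)) rfl :=
    Ext.comp_assoc _ _ _ rfl (add_zero 1) (by lia)
  constructor
  · intro h
    have h2 : (R.syzSeq_shortExact n).extClass.comp (Ext.mk₀ (R.descSyz f hf)) (add_zero 1) = 0 :=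
      (R.syzClass_comp_bijective F n 0 rfl).1 (by
        change (R.syzClass n).comp _ rfl = (R.syzClass n).comp 0 rfl
        rw [← h1, h, Ext.comp_zero])
    obtain ⟨t, ht⟩ := Ext.contravariant_sequence_exact₁ (R.syzSeq_shortExact n) F _ _ h2
    obtain ⟨g, rfl⟩ := (Ext.mk₀_bijective _ F).2 t
    rw [Ext.mk₀_comp_mk₀] at ht
    have h3 : R.fromSyz n ≫ g = R.descSyz f hf := (Ext.mk₀_bijective _ F).1 ht
    refine ⟨g, ?_⟩
    rw [← toSyz_fromSyz, Category.assoc, h3, toSyz_descSyz]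
  · rintro ⟨g, rfl⟩
    have h3 : R.descSyz (R.d n ≫ g) hf = R.fromSyz n ≫ g := by
      rw [← cancel_epi (R.toSyz (n + 1)), toSyz_descSyz, toSyz_fromSyz_assoc]
    rw [h1, h3, ← Ext.mk₀_comp_mk₀]
    rw [ShortComplex.ShortExact.extClass_comp_assoc]
    rw [Ext.comp_zero]

lemma ofCocycle_comp_mk₀ {n : ℕ} {F F' : C} (f : R.P n ⟶ F) (hf : R.d n ≫ f = 0) (φ : F ⟶ F') :
    (R.ofCocycle f hf : Ext.{w} X F n).comp (Ext.mk₀ φ) (add_zero n) =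
      R.ofCocycle (f ≫ φ) (by rw [← Category.assoc, hf, zero_comp]) := by
  have : R.descSyz (f ≫ φ) (by rw [← Category.assoc, hf, zero_comp]) = R.descSyz f hf ≫ φ := by
    rw [← cancel_epi (R.toSyz n), toSyz_descSyz, toSyz_descSyz_assoc]
  rw [ofCocycle, Ext.comp_assoc_of_third_deg_zero, Ext.mk₀_comp_mk₀, ofCocycle, this]

/-- Yoneda composition with the class of a short exact sequence is computed by lifting a cocycle
and applying the differential: a lift gives a morphism from the syzygy sequence, along which the
extension classes are natural. -/
lemma ofCocycle_comp_extClass {S : ShortComplex C} (hS : S.ShortExact) {n : ℕ}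
    (c : R.P n ⟶ S.X₃) (hc : R.d n ≫ c = 0) (b : R.P n ⟶ S.X₂) (a : R.P (n + 1) ⟶ S.X₁)
    (ha : R.d (n + 1) ≫ a = 0) (hb : b ≫ S.g = c) (hab : a ≫ S.f = R.d n ≫ b) :
    (R.ofCocycle c hc : Ext.{w} X S.X₃ n).comp hS.extClass rfl = R.ofCocycle a ha := by
  let φ : R.syzSeq n ⟶ S :=
    { τ₁ := R.descSyz a ha
      τ₂ := b
      τ₃ := R.descSyz c hc
      comm₁₂ := by
        change R.descSyz a ha ≫ S.f = R.fromSyz n ≫ b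
        rw [← cancel_epi (R.toSyz (n + 1)), toSyz_descSyz_assoc, toSyz_fromSyz_assoc, hab]
      comm₂₃ := by
        change b ≫ S.g = R.toSyz n ≫ R.descSyz c hc
        rw [toSyz_descSyz, hb] }
  have h := ShortComplex.ShortExact.extClass_naturality (R.syzSeq_shortExact n) hS φ
  change (((R.syzClass n).comp (Ext.mk₀ φ.τ₃) (add_zero n)).comp hS.extClass rfl) =
    ((R.syzClass n).comp (R.syzSeq_shortExact n).extClass rfl).comp (Ext.mk₀ φ.τ₁) (add_zero _)
  rw [Ext.comp_assoc_of_second_deg_zero, Ext.comp_assoc_of_third_deg_zero, h]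

end SyzygyResolution

/-! ### Abelian sheaves on the local-section site -/

namespace GSpace

open Opposite

variable {G : Type u} [Group G] [TopologicalSpace G]

/-- Abelian sheaves on the local-section site. -/
abbrev AbSheaf (G : Type u) [Group G] [TopologicalSpace G] : Type _ :=
  Sheaf (localSectionTopology G) AddCommGrpCat.{u + 1}

namespace AbSheaf

/-- The sections of an abelian sheaf over a `G`-space. -/
abbrev Sec (F : AbSheaf G) (Y : GSpace G) : Type (u + 1) := F.obj.obj (op Y)

/-- Restriction of sections. -/
def res (F : AbSheaf G) {Y Z : GSpace G} (f : Y ⟶ Z) : F.Sec Z →+ F.Sec Y := (F.obj.map f.op).hom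

/-- The map on sections induced by a morphism of sheaves. -/
def mapSec {F F' : AbSheaf G} (φ : F ⟶ F') (Y : GSpace G) : F.Sec Y →+ F'.Sec Y :=
  (φ.hom.app (op Y)).hom

lemma res_res (F : AbSheaf G) {Y Z W : GSpace G} (f : Y ⟶ Z) (g : Z ⟶ W) (s : F.Sec W) :
    F.res f (F.res g s) = F.res (f ≫ g) s :=
  (congrArg (fun f => f.hom s) (F.obj.map_comp g.op f.op)).symm

lemma mapSec_res {F F' : AbSheaf G} (φ : F ⟶ F') {Y Z : GSpace G} (f : Y ⟶ Z) (s : F.Sec Z) :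
    mapSec φ Y (F.res f s) = F'.res f (mapSec φ Z s) :=
  congrArg (fun f => f.hom s) (φ.hom.naturality f.op)

lemma mapSec_add {F F' : AbSheaf G} (φ ψ : F ⟶ F') {Y : GSpace G}
    (s : F.Sec Y) : mapSec (φ + ψ) Y s = mapSec φ Y s + mapSec ψ Y s := rfl

lemma hom_ext_sec {F F' : AbSheaf G} {φ ψ : F ⟶ F'}
    (h : ∀ (Y : GSpace G) (s : F.Sec Y), mapSec φ Y s = mapSec ψ Y s) : φ = ψ := by
  ext Y s
  exact h Y.unop s

lemma isSheaf_forget (F : AbSheaf G) :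
    Presieve.IsSheaf (localSectionTopology G) (F.obj ⋙ CategoryTheory.forget AddCommGrpCat) := by
  rw [← isSheaf_iff_isSheaf_of_type, ← Presheaf.isSheaf_iff_isSheaf_forget]
  exact F.property

/-- Sections that agree on a covering sieve are equal. -/
lemma sec_ext (F : AbSheaf G) {Y : GSpace G} {S : Sieve Y} (hS : S ∈ localSectionTopology G Y)
    {s t : F.Sec Y} (h : ∀ ⦃Z : GSpace G⦄ (p : Z ⟶ Y), S p → F.res p s = F.res p t) : s = t :=
  (F.isSheaf_forget S hS).isSeparatedFor.ext fun _ p hp => h p hp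

/-- Sections over the members of a covering family that agree on overlaps can be glued. -/
lemma exists_glue (F : AbSheaf G) {Y : GSpace G} {ι : Type u} {Z : ι → GSpace G}
    (p : ∀ i, Z i ⟶ Y) (hp : AdmitsLocalSections (Presieve.ofArrows Z p)) (s : ∀ i, F.Sec (Z i))
    (h : ∀ (i j : ι) (W : GSpace G) (a : W ⟶ Z i) (b : W ⟶ Z j), a ≫ p i = b ≫ p j →
      F.res a (s i) = F.res b (s j)) :
    ∃ t : F.Sec Y, ∀ i, F.res (p i) t = s i := by
  have h1 := F.isSheaf_forget _ ((generate_mem_localSectionTopology _).2 hp)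
  rw [← Presieve.isSheafFor_iff_generate, Presieve.isSheafFor_arrows_iff] at h1
  obtain ⟨t, ht, -⟩ := h1 s fun i j W a b hab => h i j W a b hab
  exact ⟨t, ht⟩

/-- There is only the zero section over the empty `G`-space. -/
lemma sec_subsingleton (F : AbSheaf G) (Y : GSpace G) [IsEmpty Y] (s t : F.Sec Y) : s = t :=
  F.sec_ext (S := ⊥) (fun x => isEmptyElim x) fun _ _ h => h.elim

/-- An epimorphism of sheaves is surjective on sections, locally. -/
lemma exists_cover_lift {E F : AbSheaf G} (φ : E ⟶ F) [Epi φ] {Y : GSpace G} (s : F.Sec Y) :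
    ∃ S ∈ localSectionTopology G Y, ∀ ⦃Z : GSpace G⦄ (p : Z ⟶ Y), S p →
      ∃ t : E.Sec Z, mapSec φ Z t = F.res p s := by
  have h : Sheaf.IsLocallySurjective φ := (Sheaf.isLocallySurjective_iff_epi' _ φ).2 inferInstance
  exact ⟨_, h.imageSieve_mem s, fun Z p hp => hp⟩

/-! ### The free abelian sheaf on a `G`-space -/

/-- Abelian sheafification of the free presheaf on a presheaf of sets is left adjoint to the
forgetful functor. -/
noncomputable def freeAdjunction (G : Type u) [Group G] [TopologicalSpace G] :
    (Functor.whiskeringRight (GSpace G)ᵒᵖ _ _).obj AddCommGrpCat.free.{u + 1} ⋙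
        presheafToSheaf (localSectionTopology G) _ ⊣
      sheafToPresheaf _ _ ⋙ (Functor.whiskeringRight _ _ _).obj (forget AddCommGrpCat.{u + 1}) :=
  (AddCommGrpCat.adj.{u + 1}.whiskerRight _).comp (sheafificationAdjunction _ _)

/-- The free abelian sheaf generated by the functor of points of a `G`-space. -/
noncomputable def free (G : Type u) [Group G] [TopologicalSpace G] : GSpace G ⥤ AbSheaf G :=
  uliftYoneda.{u + 1} ⋙ (Functor.whiskeringRight _ _ _).obj AddCommGrpCat.free.{u + 1} ⋙
    presheafToSheaf _ _

/-- The universal property of the free abelian sheaf on a `G`-space, as a bijection. -/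
noncomputable def freeHomEquiv (Y : GSpace G) (F : AbSheaf G) :
    ((free G).obj Y ⟶ F) ≃ F.Sec Y :=
  ((freeAdjunction G).homEquiv (uliftYoneda.{u + 1}.obj Y) F).trans uliftYonedaEquiv.{u + 1}

lemma freeHomEquiv_comp {Y : GSpace G} {F F' : AbSheaf G} (φ : (free G).obj Y ⟶ F) (ψ : F ⟶ F') :
    freeHomEquiv Y F' (φ ≫ ψ) = mapSec ψ Y (freeHomEquiv Y F φ) :=
  congrArg uliftYonedaEquiv.{u + 1} ((freeAdjunction G).homEquiv_naturality_right φ ψ)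

lemma freeHomEquiv_map_comp {Y Z : GSpace G} (f : Y ⟶ Z) {F : AbSheaf G}
    (φ : (free G).obj Z ⟶ F) :
    freeHomEquiv Y F ((free G).map f ≫ φ) = F.res f (freeHomEquiv Z F φ) :=
  (congrArg uliftYonedaEquiv.{u + 1} ((freeAdjunction G).homEquiv_naturality_left
    (uliftYoneda.{u + 1}.map f) φ)).trans (uliftYonedaEquiv_naturality _ f.op).symm

/-- The universal property of the free abelian sheaf on a `G`-space. -/
noncomputable def freeHomAddEquiv (Y : GSpace G) (F : AbSheaf G) :
    ((free G).obj Y ⟶ F) ≃+ F.Sec Y where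
  toEquiv := freeHomEquiv Y F
  map_add' φ ψ := by
    change freeHomEquiv Y F _ = freeHomEquiv Y F _ + freeHomEquiv Y F _
    rw [← Category.id_comp (φ + ψ), freeHomEquiv_comp, mapSec_add, ← freeHomEquiv_comp,
      ← freeHomEquiv_comp, Category.id_comp, Category.id_comp]

lemma freeHomAddEquiv_comp {Y : GSpace G} {F F' : AbSheaf G} (φ : (free G).obj Y ⟶ F)
    (ψ : F ⟶ F') : freeHomAddEquiv Y F' (φ ≫ ψ) = mapSec ψ Y (freeHomAddEquiv Y F φ) :=
  freeHomEquiv_comp φ ψ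

lemma freeHomAddEquiv_map_comp {Y Z : GSpace G} (f : Y ⟶ Z) {F : AbSheaf G}
    (φ : (free G).obj Z ⟶ F) :
    freeHomAddEquiv Y F ((free G).map f ≫ φ) = F.res f (freeHomAddEquiv Z F φ) :=
  freeHomEquiv_map_comp f φ

/-- If sections over `Y` lift along epimorphisms, then the free sheaf on `Y` is projective. -/
lemma projective_free {Y : GSpace G}
    (h : ∀ {E F : AbSheaf G} (φ : E ⟶ F) [Epi φ], Function.Surjective (mapSec φ Y)) :
    Projective ((free G).obj Y) where
  factors {E F} f φ _ := by
    obtain ⟨t, ht⟩ := h φ (freeHomAddEquiv Y _ f)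
    refine ⟨(freeHomAddEquiv Y _).symm t, (freeHomAddEquiv Y _).injective ?_⟩
    rw [freeHomAddEquiv_comp, AddEquiv.apply_symm_apply, ht]

end AbSheaf

end GSpace

namespace GSpace

open Opposite

/-! ### The Čech nerve of the covering of the point by `G` -/

section Power

variable (G : Type u) [Group G] [TopologicalSpace G] [ContinuousMul G]

/-- The `G`-space `G ^ (n + 1)` with the diagonal action by left translation. -/
def power (n : ℕ) : GSpace G where
  carrier := Fin (n + 1) → G

variable {G}

/-- The morphism `G ^ (n + 1) ⟶ G ^ (m + 1)` that reindexes the coordinates. -/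
def powerMap {n m : ℕ} (σ : Fin (m + 1) → Fin (n + 1)) : power G n ⟶ power G m :=
  Hom.mk (fun (x : Fin (n + 1) → G) j => x (σ j))
    (continuous_pi fun j => continuous_apply (σ j)) (fun _ _ => rfl)

/-- The morphism `G ^ (n + 2) ⟶ G ^ (n + 1)` that omits the `i`-th coordinate. -/
def face {n : ℕ} (i : Fin (n + 2)) : power G (n + 1) ⟶ power G n := powerMap i.succAbove

variable (G) in
/-- The simplicial `G`-space of the powers of `G`. -/
def nerve : SimplicialObject (GSpace G) where
  obj k := power G k.unop.len
  map f := powerMap f.unop.toOrderHom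
  map_id _ := rfl
  map_comp _ _ := rfl

end Power

namespace AbSheaf

variable {G : Type u} [Group G] [TopologicalSpace G]

/-! ### The sheaf of sections over products with `G` -/

/-- The functor `T ↦ T × G` on `G`-spaces. -/
def prodSelf (G : Type u) [Group G] [TopologicalSpace G] [ContinuousMul G] :
    GSpace G ⥤ GSpace G where
  obj T := { carrier := T × G }
  map {T T'} f := Hom.mk (fun x : T × G => (fn f x.1, x.2))
    (((continuous_fn f).comp continuous_fst).prodMk continuous_snd)
    (fun g x => Prod.ext (fn_smul f g x.1) rfl)

/-- The projection `T × G ⟶ T`. -/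
def prodFst [ContinuousMul G] (T : GSpace G) : (prodSelf G).obj T ⟶ T :=
  Hom.mk (fun x : T × G => x.1) continuous_fst (fun _ _ => rfl)

/-- A pair of morphisms to `T` and `G` defines a morphism to `T × G`. -/
def prodLift [ContinuousMul G] {W T T' : GSpace G} (a : W ⟶ T) (b : W ⟶ (prodSelf G).obj T') :
    W ⟶ (prodSelf G).obj T :=
  Hom.mk (fun x => ((fn a x, (fn b x : T' × G).2) : T × G))
    ((continuous_fn a).prodMk (continuous_snd.comp (continuous_fn b)))
    (fun g x => Prod.ext (fn_smul a g x)
      (congrArg (fun y : T' × G => y.2) (fn_smul b g x)))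

lemma prodSelf_coverPreserving [ContinuousMul G] :
    CoverPreserving (localSectionTopology G) (localSectionTopology G) (prodSelf G) where
  cover_preserve {T S} hS := by
    intro (x : T × G)
    obtain ⟨V, hV, ht, Z, p, hp, s, hs, hsp⟩ := hS x.1
    let W : Set ((prodSelf G).obj T) := fn (prodFst T) ⁻¹' V
    have hfst : Continuous fun v : W => fn (prodFst T) v.1 :=
      (continuous_fn (prodFst T)).comp continuous_subtype_val
    have hsnd : Continuous fun v : W => (v.1 : T × G).2 :=
      (continuous_snd : Continuous (Prod.snd : T × G → G)).comp continuous_subtype_val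
    exact ⟨W, hV.preimage (continuous_fn (prodFst T)), ht, (prodSelf G).obj Z, (prodSelf G).map p,
      Sieve.image_mem_functorPushforward _ _ hp,
      fun v => ((s ⟨fn (prodFst T) v.1, v.2⟩, (v.1 : T × G).2) : Z × G),
      (hs.comp (Continuous.subtype_mk hfst _)).prodMk hsnd,
      fun v => Prod.ext (hsp ⟨fn (prodFst T) v.1, v.2⟩) rfl⟩

lemma prodSelf_compatiblePreserving [ContinuousMul G] :
    CompatiblePreserving.{v} (localSectionTopology G) (prodSelf G) where
  compatible F {T S x} hx {Y₁ Y₂ X} f₁ f₂ {g₁ g₂} hg₁ hg₂ h := by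
    -- `f₁` and `f₂` have the same component in `G`, so both are restrictions to the graph of that
    -- component of morphisms defined on `X × G`
    let c : X ⟶ (prodSelf G).obj X := prodLift (𝟙 X) f₁
    have h1 : f₁ = c ≫ (prodSelf G).map (f₁ ≫ prodFst Y₁) := rfl
    have h2 : f₂ = c ≫ (prodSelf G).map (f₂ ≫ prodFst Y₂) :=
      fn_ext fun y => Prod.ext rfl (congrArg Prod.snd (congrArg (fun k => fn k y) h)).symm
    have h3 : (f₁ ≫ prodFst Y₁) ≫ g₁ = (f₂ ≫ prodFst Y₂) ≫ g₂ :=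
      fn_ext fun y => congrArg Prod.fst (congrArg (fun k => fn k y) h)
    have h4 := hx _ _ hg₁ hg₂ h3
    have h5 : ∀ {Y : GSpace G} (f : X ⟶ Y) (s : F.obj.obj (op ((prodSelf G).obj Y))),
        F.obj.map (c ≫ (prodSelf G).map f).op s =
          F.obj.map c.op (F.obj.map ((prodSelf G).map f).op s) := fun f s => by
      rw [op_comp, Functor.map_comp, types_comp_apply]
    rw [h1, h2, h5, h5]
    exact congrArg (F.obj.map c.op) h4

instance [ContinuousMul G] : (prodSelf G).IsContinuous (localSectionTopology G)
    (localSectionTopology G) :=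
  Functor.isContinuous_of_coverPreserving prodSelf_compatiblePreserving prodSelf_coverPreserving

/-- The sheaf `T ↦ F (T × G)`. -/
def coind [ContinuousMul G] (F : AbSheaf G) : AbSheaf G :=
  ((prodSelf G).sheafPushforwardContinuous AddCommGrpCat.{u + 1} (localSectionTopology G)
    (localSectionTopology G)).obj F

/-- The morphism `F ⟶ coind F` given by pullback along the projections `T × G ⟶ T`. -/
def coindUnit [ContinuousMul G] (F : AbSheaf G) : F ⟶ coind F :=
  ⟨{ app := fun T => F.obj.map (prodFst T.unop).op
     naturality := fun T T' f => by
       change F.obj.map _ ≫ F.obj.map _ = F.obj.map _ ≫ F.obj.map _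
       rw [← Functor.map_comp, ← Functor.map_comp]
       rfl }⟩

lemma mapSec_coindUnit [ContinuousMul G] (F : AbSheaf G) {T : GSpace G} (s : F.Sec T) :
    mapSec (coindUnit F) T s = F.res (prodFst T) s := rfl

lemma admitsLocalSections_singleton {Y Z : GSpace G} (p : Z ⟶ Y) (s : Y → Z) (hs : Continuous s)
    (hp : ∀ y, fn p (s y) = y) : AdmitsLocalSections (Presieve.singleton p) := fun _ =>
  ⟨Set.univ, isOpen_univ, trivial, Z, p, ⟨⟩, fun v => s v.1, hs.comp continuous_subtype_val,
    fun v => hp v.1⟩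

lemma res_injective (F : AbSheaf G) {Y Z : GSpace G} (p : Z ⟶ Y) (s : Y → Z) (hs : Continuous s)
    (hp : ∀ y, fn p (s y) = y) : Function.Injective (F.res p) := by
  intro a b hab
  refine F.sec_ext ((generate_mem_localSectionTopology _).2
    (admitsLocalSections_singleton p s hs hp)) ?_
  rintro W _ ⟨_, q, _, ⟨⟩, rfl⟩
  rw [← res_res, ← res_res, hab]

instance [ContinuousMul G] (F : AbSheaf G) : Mono (coindUnit F) where
  right_cancellation {E} φ ψ h := by
    refine hom_ext_sec fun Y s => ?_
    refine F.res_injective (prodFst Y) (fun y => ((y, 1) : Y × G)) (by fun_prop) (fun _ => rfl) ?_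
    exact congrArg (fun k => mapSec k Y s) h

/-! ### The Čech complex of a sheaf -/

/-- The differential `F (G ^ (n + 1)) → F (G ^ (n + 2))` of the Čech complex. -/
def cechD [ContinuousMul G] (F : AbSheaf G) (n : ℕ) : F.Sec (power G n) →+ F.Sec (power G (n + 1)) :=
  ∑ i : Fin (n + 2), (-1 : ℤ) ^ (i : ℕ) • F.res (face i)

lemma cechD_apply [ContinuousMul G] (F : AbSheaf G) (n : ℕ) (s : F.Sec (power G n)) :
    F.cechD n s = ∑ i : Fin (n + 2), (-1 : ℤ) ^ (i : ℕ) • F.res (face i) s := by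
  simp [cechD]

/-- The morphism `G ^ (n + 1) × G ⟶ G ^ (n + 2)` that inserts a new zeroth coordinate. -/
def powerCons [ContinuousMul G] (n : ℕ) : (prodSelf G).obj (power G n) ⟶ power G (n + 1) :=
  Hom.mk (fun x : (Fin (n + 1) → G) × G => (Fin.cons x.2 x.1 : Fin (n + 2) → G))
    (continuous_pi (Fin.cases continuous_snd fun j => (continuous_apply j).comp continuous_fst))
    (fun _ _ => funext (Fin.cases rfl fun _ => rfl))

/-- A Čech cocycle of positive degree becomes a coboundary in `coind F`: the contracting homotopy
inserts the additional coordinate. -/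
lemma exists_cechD_coind [ContinuousMul G] (F : AbSheaf G) (n : ℕ) (s : F.Sec (power G (n + 1)))
    (hs : F.cechD (n + 1) s = 0) :
    ∃ t : (coind F).Sec (power G n),
      (coind F).cechD n t = mapSec (coindUnit F) (power G (n + 1)) s := by
  let t : (coind F).Sec (power G n) := F.res (powerCons n) s
  refine ⟨t, ?_⟩
  have h := congrArg (F.res (powerCons (n + 1))) hs
  rw [cechD_apply, Fin.sum_univ_succ, map_add, map_sum, map_zero] at h
  simp only [map_zsmul, res_res, Fin.val_zero, pow_zero, one_smul, Fin.val_succ] at h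
  rw [add_eq_zero_iff_eq_neg] at h
  rw [mapSec_coindUnit]
  refine Eq.trans ?_ h.symm
  rw [cechD_apply, ← Finset.sum_neg_distrib]
  refine Finset.sum_congr rfl fun i _ => ?_
  rw [pow_succ, mul_neg_one, neg_smul, neg_neg]
  congr 1
  refine (F.res_res _ _ _).trans (congrArg (fun k => F.res k s) (fn_ext fun x => ?_))
  exact funext (Fin.cases rfl fun j => congrArg (Fin.cons (α := fun _ => G) x.2 x.1)
    (Fin.succ_succAbove_succ i j).symm)

/-- The differential of the Čech complex of free sheaves. -/
noncomputable def freeD (G : Type u) [Group G] [TopologicalSpace G] [ContinuousMul G] (n : ℕ) :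
    (free G).obj (power G (n + 1)) ⟶ (free G).obj (power G n) :=
  ∑ i : Fin (n + 2), (-1 : ℤ) ^ (i : ℕ) • (free G).map (face i)

lemma freeD_comp_freeD [ContinuousMul G] (n : ℕ) : freeD G (n + 1) ≫ freeD G n = 0 :=
  AlgebraicTopology.AlternatingFaceMapComplex.d_squared
    (((SimplicialObject.whiskering _ _).obj (free G)).obj (nerve G)) n

lemma freeHomAddEquiv_freeD_comp [ContinuousMul G] {n : ℕ} {F : AbSheaf G}
    (φ : (free G).obj (power G n) ⟶ F) :
    freeHomAddEquiv _ F (freeD G n ≫ φ) = F.cechD n (freeHomAddEquiv _ F φ) := by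
  simp only [freeD, Preadditive.sum_comp, Preadditive.zsmul_comp, map_sum, map_zsmul, cechD_apply,
    freeHomAddEquiv_map_comp]

lemma mono_desc_freeD [ContinuousMul G] (n : ℕ) :
    Mono (Limits.cokernel.desc (freeD G (n + 1)) (freeD G n) (freeD_comp_freeD n)) := by
  let Q := Limits.cokernel (freeD G (n + 1))
  let q : (free G).obj (power G (n + 1)) ⟶ Q := Limits.cokernel.π _
  obtain ⟨t, ht⟩ := exists_cechD_coind Q n (freeHomAddEquiv _ Q q) (by
    rw [← freeHomAddEquiv_freeD_comp, Limits.cokernel.condition, map_zero])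
  have h : Limits.cokernel.desc (freeD G (n + 1)) (freeD G n) (freeD_comp_freeD n) ≫
      (freeHomAddEquiv _ (coind Q)).symm t = coindUnit Q := by
    rw [← cancel_epi q, Limits.cokernel.π_desc_assoc]
    apply (freeHomAddEquiv _ _).injective
    rw [freeHomAddEquiv_freeD_comp, AddEquiv.apply_symm_apply, freeHomAddEquiv_comp, ht]
  exact mono_of_mono_fac h

/-! ### The constant sheaf -/

/-- The constant sheaf with value the integers. -/
noncomputable abbrev constZ (G : Type u) [Group G] [TopologicalSpace G] : AbSheaf G :=
  (constantSheaf (localSectionTopology G) AddCommGrpCat.{u + 1}).obj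
    (AddCommGrpCat.of (ULift.{u + 1} ℤ))

/-- Morphisms from the constant sheaf correspond to sections over the point. -/
noncomputable def constHomAddEquiv (F : AbSheaf G) : (constZ G ⟶ F) ≃+ F.Sec (point G) :=
  ((constantSheafAdj _ _ pointIsTerminal).homAddEquiv _ F).trans
    (AddCommGrpCat.uliftZMultiplesAddEquiv _)

lemma constHomAddEquiv_comp {F F' : AbSheaf G} (φ : constZ G ⟶ F) (ψ : F ⟶ F') :
    constHomAddEquiv F' (φ ≫ ψ) = mapSec ψ _ (constHomAddEquiv F φ) :=
  congrArg (AddCommGrpCat.uliftZMultiplesAddEquiv _)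
    ((constantSheafAdj _ _ pointIsTerminal).homEquiv_naturality_right φ ψ)

/-- The morphism from a `G`-space to the point. -/
def toPoint (Y : GSpace G) : Y ⟶ point G := pointIsTerminal.from Y

lemma cechD_zero_apply [ContinuousMul G] (F : AbSheaf G) (s : F.Sec (power G 0)) :
    F.cechD 0 s = F.res (face 0) s - F.res (face 1) s := by
  rw [cechD_apply, Fin.sum_univ_two]
  simp [sub_eq_add_neg]

/-- Čech cocycles of degree zero descend to sections over the point. -/
lemma exists_res_toPoint_eq [ContinuousMul G] (F : AbSheaf G) (s : F.Sec (power G 0))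
    (hs : F.cechD 0 s = 0) : ∃ t : F.Sec (point G), F.res (toPoint _) t = s := by
  rw [cechD_zero_apply, sub_eq_zero] at hs
  obtain ⟨t, ht⟩ := F.exists_glue (ι := PUnit) (fun _ => toPoint (power G 0))
    (fun x => ⟨Set.univ, isOpen_univ, trivial, _, _, ⟨PUnit.unit⟩, fun _ => (1 : Fin 1 → G),
      continuous_const, fun _ => rfl⟩) (fun _ => s) (fun _ _ W a b _ => by
    let c : W ⟶ power G 1 := Hom.mk
      (fun x => (Fin.cons ((fn b x : Fin 1 → G) 0) (fn a x) : Fin 2 → G))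
      (continuous_pi (Fin.cases
        (show Continuous fun x => (fn b x : Fin 1 → G) 0 from
          (continuous_apply (0 : Fin 1)).comp (continuous_fn b))
        fun j => (continuous_apply j).comp (continuous_fn a)))
      (fun g x => funext (Fin.cases (congrFun (fn_smul b g x) (0 : Fin 1))
        fun j => congrFun (fn_smul a g x) j))
    have ha : a = c ≫ face 0 := rfl
    have hb : b = c ≫ face 1 := fn_ext fun x => funext fun j : Fin 1 => by
      rw [Subsingleton.elim j 0]
      rfl
    rw [ha, hb, ← res_res, ← res_res, hs])
  exact ⟨t, ht PUnit.unit⟩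

lemma res_toPoint_power_injective [ContinuousMul G] (F : AbSheaf G) (n : ℕ) :
    Function.Injective (F.res (toPoint (power G n))) :=
  F.res_injective _ (fun _ => (1 : Fin (n + 1) → G)) continuous_const (fun _ => rfl)

lemma cechD_zero_res_toPoint [ContinuousMul G] (F : AbSheaf G) (t : F.Sec (point G)) :
    F.cechD 0 (F.res (toPoint _) t) = 0 := by
  rw [cechD_zero_apply, res_res, res_res, sub_eq_zero]
  rfl

/-- The augmentation of the Čech complex of free sheaves. -/
noncomputable def freeAug (G : Type u) [Group G] [TopologicalSpace G] [ContinuousMul G] :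
    (free G).obj (power G 0) ⟶ constZ G :=
  (freeHomAddEquiv _ _).symm ((constZ G).res (toPoint _) (constHomAddEquiv _ (𝟙 _)))

lemma freeHomAddEquiv_freeAug_comp [ContinuousMul G] {F : AbSheaf G} (φ : constZ G ⟶ F) :
    freeHomAddEquiv _ F (freeAug G ≫ φ) = F.res (toPoint _) (constHomAddEquiv F φ) := by
  rw [freeHomAddEquiv_comp, freeAug, AddEquiv.apply_symm_apply, mapSec_res,
    ← constHomAddEquiv_comp, Category.id_comp]

lemma freeD_comp_freeAug [ContinuousMul G] : freeD G 0 ≫ freeAug G = 0 := by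
  apply (freeHomAddEquiv _ _).injective
  rw [freeHomAddEquiv_freeD_comp, ← Category.comp_id (freeAug G), freeHomAddEquiv_freeAug_comp,
    cechD_zero_res_toPoint, map_zero]

instance [ContinuousMul G] :
    IsIso (Limits.cokernel.desc (freeD G 0) (freeAug G) freeD_comp_freeAug) := by
  rw [isIso_iff_coyoneda_map_bijective]
  intro F
  constructor
  · intro φ ψ h
    apply (constHomAddEquiv F).injective
    apply F.res_toPoint_power_injective 0
    rw [← freeHomAddEquiv_freeAug_comp, ← freeHomAddEquiv_freeAug_comp,
      ← Limits.cokernel.π_desc (freeD G 0) (freeAug G) freeD_comp_freeAug, Category.assoc,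
      Category.assoc]
    exact congrArg (fun k => freeHomAddEquiv _ F (Limits.cokernel.π _ ≫ k)) h
  · intro φ
    obtain ⟨t, ht⟩ := F.exists_res_toPoint_eq
      (freeHomAddEquiv _ F (Limits.cokernel.π (freeD G 0) ≫ φ)) (by
        rw [← freeHomAddEquiv_freeD_comp, Limits.cokernel.condition_assoc, Limits.zero_comp,
          map_zero])
    refine ⟨(constHomAddEquiv F).symm t, ?_⟩
    change Limits.cokernel.desc _ _ _ ≫ _ = φ
    rw [← cancel_epi (Limits.cokernel.π (freeD G 0)), Limits.cokernel.π_desc_assoc]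
    apply (freeHomAddEquiv _ F).injective
    rw [freeHomAddEquiv_freeAug_comp, AddEquiv.apply_symm_apply, ht]

/-- If the free sheaves on the powers of `G` are projective, then they resolve the constant
sheaf. -/
noncomputable abbrev cechResolution [ContinuousMul G]
    (h : ∀ n, Projective ((free G).obj (power G n))) : SyzygyResolution (constZ G) where
  P n := (free G).obj (power G n)
  d := freeD G
  d_comp_d := freeD_comp_freeD
  projective := h
  mono_desc := mono_desc_freeD
  aug := (asIso (Limits.cokernel.desc (freeD G 0) (freeAug G) freeD_comp_freeAug)).symm

lemma toSyz_augIso_inv_cechResolution [ContinuousMul G]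
    (h : ∀ n, Projective ((free G).obj (power G n))) :
    (cechResolution h).toSyz 0 ≫ (cechResolution h).augIso.inv = freeAug G :=
  Limits.cokernel.π_desc _ _ _

end AbSheaf

end GSpace

/-! ### Open covers of disjoint unions of profinite spaces -/

/-- A space `X` is a disjoint union of compact open subsets: it has a locally constant function with
compact fibres. -/
def HasCompactPartition (X : Type*) [TopologicalSpace X] : Prop :=
  ∃ (E : Type) (q : X → E), IsLocallyConstant q ∧ ∀ e, IsCompact (q ⁻¹' {e})

lemma HasCompactPartition.pi {X : Type*} [TopologicalSpace X] (h : HasCompactPartition X) (n : ℕ) :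
    HasCompactPartition (Fin n → X) := by
  obtain ⟨E, q, hq, hc⟩ := h
  refine ⟨Fin n → E, fun x j => q (x j), ?_, fun e => ?_⟩
  · rw [IsLocallyConstant.iff_exists_open]
    intro x
    refine ⟨Set.univ.pi fun j => q ⁻¹' {q (x j)},
      isOpen_set_pi Set.finite_univ fun j _ => hq _, fun j _ => rfl, fun y hy => ?_⟩
    exact funext fun j => hy j trivial
  · convert isCompact_univ_pi fun j => hc (e j) using 1
    ext x
    simp [funext_iff]

/-- For every choice of a neighbourhood of each point of a profinite space, there is a partition
into open subsets, each contained in one of these neighbourhoods. -/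
lemma exists_isLocallyConstant_mem_of_compactSpace {X : Type*} [TopologicalSpace X]
    [CompactSpace X] [T2Space X] [TotallyDisconnectedSpace X] (U : X → Set X)
    (hU : ∀ x, IsOpen (U x)) (hxU : ∀ x, x ∈ U x) :
    ∃ f : X → X, IsLocallyConstant f ∧ ∀ x, x ∈ U (f x) := by
  obtain ⟨n, W, hW, hcov, hdis⟩ :=
    TopologicalSpace.IsOpenCover.exists_finite_nonempty_disjoint_clopen_cover
      (U := fun x => (⟨U x, hU x⟩ : TopologicalSpace.Opens X))
      (TopologicalSpace.IsOpenCover.of_sets _ (Set.iUnion_eq_univ_iff.2 fun x => ⟨x, hxU x⟩))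
  choose c hc using fun j => (hW j).2
  choose j hj using fun x => Set.mem_iUnion.1 (hcov (Set.mem_univ x))
  refine ⟨fun x => c (j x), ?_, fun x => hc _ (hj x)⟩
  rw [IsLocallyConstant.iff_exists_open]
  refine fun x => ⟨W (j x), (W (j x)).2.2, hj x, fun y hy => ?_⟩
  have h : j y = j x := by
    by_contra hne
    exact Set.disjoint_left.1 (TopologicalSpace.Clopens.coe_disjoint.2 (hdis hne)) (hj y) hy
  exact congrArg c h

/-- For every choice of a neighbourhood of each point of a disjoint union of profinite spaces, there
is a partition into open subsets, each contained in one of these neighbourhoods. -/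
lemma HasCompactPartition.exists_isLocallyConstant_mem {X : Type*} [TopologicalSpace X]
    [T2Space X] [TotallyDisconnectedSpace X] (h : HasCompactPartition X) (U : X → Set X)
    (hU : ∀ x, IsOpen (U x)) (hxU : ∀ x, x ∈ U x) :
    ∃ f : X → X, IsLocallyConstant f ∧ ∀ x, x ∈ U (f x) := by
  obtain ⟨E, q, hq, hcomp⟩ := h
  have key : ∀ e : E, ∃ f : q ⁻¹' {e} → q ⁻¹' {e}, IsLocallyConstant f ∧
      ∀ x, x.1 ∈ U (f x).1 := fun e =>
    haveI : CompactSpace (q ⁻¹' {e}) := isCompact_iff_compactSpace.1 (hcomp e)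
    exists_isLocallyConstant_mem_of_compactSpace (fun x => Subtype.val ⁻¹' U x.1)
      (fun x => (hU x.1).preimage continuous_subtype_val) (fun x => hxU x.1)
  choose f hf hfU using key
  refine ⟨fun x => (f (q x) ⟨x, rfl⟩).1, ?_, fun x => hfU (q x) ⟨x, rfl⟩⟩
  rw [IsLocallyConstant.iff_exists_open]
  intro x
  refine ⟨Subtype.val '' (f (q x) ⁻¹' {f (q x) ⟨x, rfl⟩}),
    (hq {q x}).isOpenMap_subtype_val _ (hf (q x) _), ⟨⟨x, rfl⟩, rfl, rfl⟩, ?_⟩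
  rintro _ ⟨⟨y, hy⟩, hyf, rfl⟩
  have hy' : q y = q x := hy
  have h1 : ∀ (e : E) (he : q y = e), (f (q y) ⟨y, rfl⟩).1 = (f e ⟨y, he⟩).1 := by
    rintro _ rfl
    rfl
  exact (h1 _ hy').trans (congrArg Subtype.val hyf)

/-! ### Projectivity of the free sheaves on the powers of `G` -/

namespace GSpace

variable {G : Type u} [Group G] [TopologicalSpace G]

/-- The `G`-stable subspace of a `G`-space on which an invariant function has a given value. -/
def fiber {Y : GSpace G} {D : Type u} (f : Y → D) (hf : ∀ (g : G) (y : Y), f (g • y) = f y)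
    (d : D) : GSpace G :=
  letI : MulAction G {y : Y // f y = d} :=
    { smul := fun g y => ⟨g • y.1, (hf g y.1).trans y.2⟩
      one_smul := fun y => Subtype.ext (one_smul G y.1)
      mul_smul := fun a b y => Subtype.ext (mul_smul a b y.1) }
  { carrier := {y : Y // f y = d}
    continuousSMul := ⟨Continuous.subtype_mk
      (continuous_fst.smul (continuous_subtype_val.comp continuous_snd)) _⟩ }

/-- The inclusion of a fibre of an invariant function. -/
def fiberι {Y : GSpace G} {D : Type u} (f : Y → D) (hf : ∀ (g : G) (y : Y), f (g • y) = f y)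
    (d : D) : fiber f hf d ⟶ Y :=
  Hom.mk (fun y => y.1) continuous_subtype_val (fun _ _ => rfl)

/-- The fibres of a locally constant invariant function cover. -/
lemma admitsLocalSections_fiberι {Y : GSpace G} {D : Type u} (f : Y → D)
    (hf : ∀ (g : G) (y : Y), f (g • y) = f y) (hloc : IsLocallyConstant f) :
    AdmitsLocalSections (Presieve.ofArrows _ (fiberι f hf)) := fun y =>
  ⟨f ⁻¹' {f y}, hloc _, rfl, _, _, ⟨f y⟩, fun v => ⟨v.1, v.2⟩,
    Continuous.subtype_mk continuous_subtype_val _, fun _ => rfl⟩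

/-- If `f` is locally constant and invariant, then sections over the fibres of `f` can be glued: a
sheaf turns the disjoint union into a product. -/
lemma AbSheaf.exists_glue_fiber (F : AbSheaf G) {Y : GSpace G} {D : Type u} (f : Y → D)
    (hf : ∀ (g : G) (y : Y), f (g • y) = f y) (hloc : IsLocallyConstant f)
    (s : ∀ d, F.Sec (fiber f hf d)) :
    ∃ t : F.Sec Y, ∀ d, F.res (fiberι f hf d) t = s d := by
  refine F.exists_glue (fiberι f hf) (admitsLocalSections_fiberι f hf hloc) s
    fun d e W a b hab => ?_
  have hab' : ∀ w : W, (fn a w).1 = (fn b w).1 := fun w => congrArg (fun k => fn k w) hab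
  rcases isEmpty_or_nonempty W with hW | ⟨⟨w⟩⟩
  · exact F.sec_subsingleton W _ _
  · obtain rfl : d = e := (fn a w).2.symm.trans ((congrArg f (hab' w)).trans (fn b w).2)
    rw [show a = b from fn_ext fun w => Subtype.ext (hab' w)]

/-- If every covering sieve of `Y` contains all the fibres of some locally constant invariant
function, then epimorphisms of sheaves are surjective on sections over `Y`. -/
lemma AbSheaf.mapSec_surjective {Y : GSpace G}
    (hY : ∀ S ∈ localSectionTopology G Y, ∃ (D : Type u) (f : Y → D)
      (hf : ∀ (g : G) (y : Y), f (g • y) = f y), IsLocallyConstant f ∧ ∀ d, S (fiberι f hf d))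
    {E F : AbSheaf G} (φ : E ⟶ F) [Epi φ] : Function.Surjective (mapSec φ Y) := by
  intro s
  obtain ⟨S, hS, hlift⟩ := exists_cover_lift φ s
  obtain ⟨D, f, hf, hloc, hfS⟩ := hY S hS
  choose t ht using fun d => hlift _ (hfS d)
  obtain ⟨t', ht'⟩ := E.exists_glue_fiber f hf hloc t
  refine ⟨t', F.sec_ext ((generate_mem_localSectionTopology _).2
    (admitsLocalSections_fiberι f hf hloc)) ?_⟩
  rintro Z _ ⟨_, q, _, ⟨d⟩, rfl⟩
  rw [← res_res, ← res_res, ← mapSec_res, ht', ht]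

/-- A covering sieve of `G ^ (n + 1)` contains the members of a partition into open `G`-stable
subsets. Over the slice where the zeroth coordinate is `1`, which is `G ^ n`, the local sections can
be chosen on the members of a partition; they extend equivariantly. -/
lemma exists_fiber_mem_of_power [IsTopologicalGroup G] [T2Space G] [TotallyDisconnectedSpace G]
    (hG : HasCompactPartition G) (n : ℕ) (S : Sieve (power G n))
    (hS : S ∈ localSectionTopology G (power G n)) :
    ∃ (D : Type u) (f : power G n → D) (hf : ∀ (g : G) (y : power G n), f (g • y) = f y),
      IsLocallyConstant f ∧ ∀ d, S (fiberι f hf d) := by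
  -- the slice, and the retraction `y ↦ (y 0)⁻¹ • y` onto it
  let i : (Fin n → G) → power G n := fun x => (Fin.cons 1 x : Fin (n + 1) → G)
  have hi : Continuous i := continuous_pi (Fin.cases continuous_const fun j => continuous_apply j)
  let z : power G n → G := fun y => (y : Fin (n + 1) → G) 0
  have hz : Continuous z := continuous_apply (0 : Fin (n + 1))
  let ρ : power G n → Fin n → G := fun y j => (z y)⁻¹ * (y : Fin (n + 1) → G) j.succ
  have hρ : Continuous ρ := continuous_pi fun j => hz.inv.mul (continuous_apply j.succ)
  have hρi : ∀ (g : G) (y : power G n), ρ (g • y) = ρ y := fun g y => funext fun j => by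
    change (g * (y : Fin (n + 1) → G) 0)⁻¹ * (g * (y : Fin (n + 1) → G) j.succ) =
      ((y : Fin (n + 1) → G) 0)⁻¹ * (y : Fin (n + 1) → G) j.succ
    group
  have hzi : ∀ y, z y • i (ρ y) = y := fun y => funext (Fin.cases (mul_one _) fun j =>
    mul_inv_cancel_left _ _)
  choose V hV hxV Z p hp s hs hsp using fun x : Fin n → G => hS (i x)
  obtain ⟨f, hf, hfV⟩ := (hG.pi n).exists_isLocallyConstant_mem (fun x => i ⁻¹' V x)
    (fun x => (hV x).preimage hi) hxV
  refine ⟨Fin n → G, f ∘ ρ, fun g y => congrArg f (hρi g y), hf.comp_continuous hρ, fun d => ?_⟩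
  have hmem : ∀ y : fiber (f ∘ ρ) (fun g y => congrArg f (hρi g y)) d, i (ρ y.1) ∈ V d := by
    intro y
    have h1 : f (ρ y.1) = d := y.2
    have h2 := hfV (ρ y.1)
    rw [h1] at h2
    exact h2
  let q : fiber (f ∘ ρ) (fun g y => congrArg f (hρi g y)) d ⟶ Z d :=
    Hom.mk (fun y => z y.1 • s d ⟨i (ρ y.1), hmem y⟩)
      ((hz.comp continuous_subtype_val).smul ((hs d).comp
        (Continuous.subtype_mk (hi.comp (hρ.comp continuous_subtype_val)) _)))
      (fun g y => by
        have h1 : (⟨i (ρ (g • y.1)), hmem (g • y)⟩ : V d) = ⟨i (ρ y.1), hmem y⟩ :=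
          Subtype.ext (congrArg i (hρi g y.1))
        change (g * z y.1) • s d ⟨i (ρ (g • y.1)), hmem (g • y)⟩ = _
        rw [h1, mul_smul])
  have hq : fiberι _ _ d = q ≫ p d := fn_ext fun y => by
    change y.1 = fn (p d) (z y.1 • s d ⟨i (ρ y.1), hmem y⟩)
    rw [fn_smul, hsp, hzi]
  rw [hq]
  exact S.downward_closed (hp d) q

lemma projective_free_power [IsTopologicalGroup G] [T2Space G] [TotallyDisconnectedSpace G]
    (hG : HasCompactPartition G) (n : ℕ) : Projective ((AbSheaf.free G).obj (power G n)) :=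
  AbSheaf.projective_free fun φ _ =>
    AbSheaf.mapSec_surjective (exists_fiber_mem_of_power hG n) φ

end GSpace

/-! ### The comparison isomorphism -/

namespace TopGModule

open GSpace AbSheaf

variable {G : Type u} [Group G] [TopologicalSpace G] [IsTopologicalGroup G]

/-- Continuous homogeneous cochains are the sections over the powers of `G`. -/
def cochainSec (A : TopGModule G) (n : ℕ) : A.cochains n ≃+ Sec A.sheaf (power G n) :=
  (AddEquiv.ulift.{u, u + 1} (α := A.cochains n)).symm

/-- Continuous homogeneous cochains are the morphisms from the free sheaves on the powers of
`G`. -/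
noncomputable def cochainHom (A : TopGModule G) (n : ℕ) :
    A.cochains n ≃+ ((free G).obj (power G n) ⟶ A.sheaf) :=
  (A.cochainSec n).trans (freeHomAddEquiv (power G n) A.sheaf).symm

lemma freeHomAddEquiv_cochainHom (A : TopGModule G) {n : ℕ} (f : A.cochains n) :
    freeHomAddEquiv _ _ (A.cochainHom n f) = A.cochainSec n f :=
  AddEquiv.apply_symm_apply _ _

lemma cechD_cochainSec (A : TopGModule G) {n : ℕ} (f : A.cochains n) :
    AbSheaf.cechD A.sheaf n (A.cochainSec n f) = A.cochainSec (n + 1) (A.d n f) := by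
  apply (A.cochainSec (n + 1)).symm.injective
  rw [cechD_apply, map_sum, AddEquiv.symm_apply_apply]
  refine Subtype.ext (ContinuousMap.ext fun x => ?_)
  rw [AddSubgroup.val_finsetSum, ContinuousMap.sum_apply, d_apply]
  rfl

lemma freeD_comp_cochainHom (A : TopGModule G) {n : ℕ} (f : A.cochains n) :
    freeD G n ≫ A.cochainHom n f = A.cochainHom (n + 1) (A.d n f) := by
  apply (freeHomAddEquiv _ _).injective
  rw [freeHomAddEquiv_freeD_comp, freeHomAddEquiv_cochainHom, freeHomAddEquiv_cochainHom,
    cechD_cochainSec]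

lemma cochainHom_comp_sheafMap {A B : TopGModule G} (φ : Hom A B) {n : ℕ} (f : A.cochains n) :
    A.cochainHom n f ≫ sheafMap φ = B.cochainHom n (postcomp φ _ f) := by
  apply (freeHomAddEquiv _ _).injective
  rw [freeHomAddEquiv_comp, freeHomAddEquiv_cochainHom, freeHomAddEquiv_cochainHom]
  rfl

variable (h : ∀ n, Projective ((free G).obj (power G n)))

lemma cechResolution_d_comp_cochainHom (A : TopGModule G) {n : ℕ} (z : A.cocycles n) :
    (cechResolution h).d n ≫ A.cochainHom n z.1 = 0 := by
  refine (A.freeD_comp_cochainHom z.1).trans ?_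
  rw [show A.d n z.1 = 0 from z.2]
  exact map_zero (A.cochainHom (n + 1))

/-- The class in the cohomology of the site that is represented by a continuous cocycle. -/
noncomputable def siteClass (A : TopGModule G) (n : ℕ) : A.cocycles n →+ A.siteCohomology n :=
  AddMonoidHom.mk' (fun z => (cechResolution h).ofCocycle (A.cochainHom n z.1)
    (A.cechResolution_d_comp_cochainHom h z)) fun z z' => by
      refine Eq.trans ?_ (SyzygyResolution.ofCocycle_add _ _ _ _ _)
      congr 1
      exact map_add (A.cochainHom n) z.1 z'.1

lemma siteClass_surjective (A : TopGModule G) (n : ℕ) :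
    Function.Surjective (A.siteClass h n) := by
  intro y
  obtain ⟨f, hf, rfl⟩ := (cechResolution h).ofCocycle_surjective y
  obtain ⟨z, rfl⟩ := (A.cochainHom n).surjective f
  refine ⟨⟨z, (A.cochainHom (n + 1)).injective ?_⟩, rfl⟩
  rw [map_zero, ← freeD_comp_cochainHom]
  exact hf

lemma siteClass_eq_zero_iff (A : TopGModule G) (n : ℕ) (z : A.cocycles n) :
    A.siteClass h n z = 0 ↔ z.1 ∈ A.coboundaries n := by
  cases n with
  | zero =>
    refine ((cechResolution h).ofCocycle_zero_eq_zero_iff _ _).trans ?_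
    exact map_eq_zero_iff _ (A.cochainHom 0).injective
  | succ n =>
    refine ((cechResolution h).ofCocycle_succ_eq_zero_iff _ _).trans ⟨?_, ?_⟩
    · rintro ⟨g, hg⟩
      obtain ⟨y, rfl⟩ := (A.cochainHom n).surjective g
      exact ⟨y, (A.cochainHom (n + 1)).injective ((A.freeD_comp_cochainHom y).symm.trans hg)⟩
    · rintro ⟨y, hy⟩
      refine ⟨A.cochainHom n y, (A.freeD_comp_cochainHom y).trans ?_⟩
      rw [hy]

/-- The isomorphism between continuous cochain cohomology and the cohomology of the site. -/
noncomputable def contToSite (A : TopGModule G) (n : ℕ) :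
    A.contCohomology n ≃+ A.siteCohomology n :=
  AddEquiv.ofBijective (QuotientAddGroup.lift ((A.coboundaries n).addSubgroupOf (A.cocycles n))
      (A.siteClass h n) fun z hz =>
      (A.siteClass_eq_zero_iff h n z).2 hz) <| by
    constructor
    · rw [injective_iff_map_eq_zero]
      intro x hx
      obtain ⟨z, rfl⟩ := QuotientAddGroup.mk_surjective x
      exact (QuotientAddGroup.eq_zero_iff z).2 ((A.siteClass_eq_zero_iff h n z).1 hx)
    · intro y
      obtain ⟨z, rfl⟩ := A.siteClass_surjective h n y
      exact ⟨A.contClass n z, rfl⟩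

lemma contToSite_symm_eq_iff (A : TopGModule G) (n : ℕ) (x : A.siteCohomology n)
    (z : A.cocycles n) : (A.contToSite h n).symm x = A.contClass n z ↔ x = A.siteClass h n z :=
  (A.contToSite h n).symm_apply_eq

lemma siteClass_zero_eq_iff (A : TopGModule G) (x : A.siteCohomology 0) (z : A.cocycles 0) :
    x = A.siteClass h 0 z ↔ ∀ g : Fin 1 → G, z.1.1 g = A.siteCohomologyZeroValue x := by
  obtain ⟨φ, rfl⟩ := (Abelian.Ext.mk₀_bijective _ _).2 x
  have h1 : Abelian.Ext.mk₀ φ = A.siteClass h 0 z ↔ freeAug G ≫ φ = A.cochainHom 0 z.1 := by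
    refine ((cechResolution h).mk₀_eq_ofCocycle_iff φ _ _).trans ?_
    rw [← Category.assoc, toSyz_augIso_inv_cechResolution]
  have h2 : Sheaf.H.equiv₀ A.sheaf pointIsTerminal (Abelian.Ext.mk₀ φ) =
      constHomAddEquiv A.sheaf φ :=
    congrArg (constHomAddEquiv A.sheaf) (Abelian.Ext.addEquiv₀.apply_symm_apply φ)
  rw [h1, ← (freeHomAddEquiv _ _).injective.eq_iff, freeHomAddEquiv_freeAug_comp,
    freeHomAddEquiv_cochainHom, siteCohomologyZeroValue, h2]
  constructor
  · intro h3 g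
    exact (congrArg (fun s : ULift.{u + 1} (A.cochains 0) => s.down.1 g) h3).symm
  · intro h3
    exact ULift.ext _ _ (Subtype.ext (ContinuousMap.ext fun g => (h3 g).symm))

/-- If the free sheaves on the powers of `G` are projective, then the cohomology of the
local-section site is canonically isomorphic to continuous cochain cohomology. -/
noncomputable def canonicalComparison : CanonicalComparison G where
  iso A n := (A.contToSite h n).symm
  natural {A B} φ n x := by
    obtain ⟨z, rfl⟩ := A.siteClass_surjective h n x
    rw [(A.contToSite_symm_eq_iff h n _ z).2 rfl]
    refine (B.contToSite_symm_eq_iff h n _ (cocyclesMap φ n z)).2 ?_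
    refine (SyzygyResolution.ofCocycle_comp_mk₀ _ _ _ _).trans ?_
    change SyzygyResolution.ofCocycle _ _ _ = SyzygyResolution.ofCocycle _ _ _
    congr 1
    exact cochainHom_comp_sheafMap φ z.1
  iso_zero A x z := (A.contToSite_symm_eq_iff h 0 x z).trans (A.siteClass_zero_eq_iff h x z)
  connecting {A B C} φ ψ w hS n x c b a hx hb ha := by
    obtain rfl := (C.contToSite_symm_eq_iff h n x c).1 hx
    refine (A.contToSite_symm_eq_iff h (n + 1) _ a).2 ?_
    refine SyzygyResolution.ofCocycle_comp_extClass _ hS _ _ (B.cochainHom n b) _ _ ?_ ?_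
    · exact (cochainHom_comp_sheafMap ψ b).trans (congrArg _ hb)
    · refine (cochainHom_comp_sheafMap φ a.1).trans ?_
      rw [ha]
      exact (B.freeD_comp_cochainHom b).symm

end TopGModule

/-! ### Profinite groups and Weil groups of function fields -/

lemma hasCompactPartition_of_compactSpace (X : Type*) [TopologicalSpace X] [CompactSpace X] :
    HasCompactPartition X :=
  ⟨Unit, fun _ => (), IsLocallyConstant.const (), fun _ => by
    simpa using isCompact_univ (X := X)⟩

/-- In the Galois group of an algebraic extension, the automorphisms with a given value at each
point of a given family form a closed subset. -/
lemma isClosed_setOf_forall_apply_eq {K L : Type*} [Field K] [Field L] [Algebra K L]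
    [Algebra.IsIntegral K L] {ι : Type*} (x y : ι → L) :
    IsClosed {σ : Gal(L/K) | ∀ i, σ (x i) = y i} := by
  rw [Set.ofPred_forall]
  refine isClosed_iInter fun i => ?_
  rw [← isOpen_compl_iff, isOpen_iff_forall_mem_open]
  intro σ hσ
  refine ⟨(fun τ => σ⁻¹ * τ) ⁻¹' (MulAction.stabilizer Gal(L/K) (x i) : Set Gal(L/K)), ?_,
    (stabilizer_isOpen_of_isIntegral (x i)).preimage (continuous_const_mul σ⁻¹), ?_⟩
  · intro τ hτ h
    have h1 : (σ⁻¹ * τ) • x i = x i := hτ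
    rw [mul_smul, inv_smul_eq_iff] at h1
    exact hσ (h1.symm.trans h)
  · change (σ⁻¹ * σ) • x i = x i
    rw [inv_mul_cancel, one_smul]

/-- The Weil group of a function field is the disjoint union of the fibres of its projection to the
integers, which are closed in the absolute Galois group. -/
lemma hasCompactPartition_functionFieldWeilGroup (Fq K Ks : Type*) [Field Fq] [Fintype Fq]
    [Field K] [Field Ks] [Algebra K Ks] [IsGalois K Ks] [Algebra Fq Ks] :
    HasCompactPartition (functionFieldWeilGroup Fq K Ks) := by
  refine ⟨Multiplicative ℤ, fun w => w.1.2, ?_, fun m => ?_⟩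
  · rw [IsLocallyConstant.iff_continuous]
    exact continuous_snd.comp continuous_subtype_val
  · have hC := isClosed_setOf_forall_apply_eq (K := K)
      (fun x : algebraicClosure Fq Ks => (x : Ks)) (fun x =>
        (((FiniteField.frobeniusAlgEquivOfAlgebraic Fq (algebraicClosure Fq Ks) ^
          Multiplicative.toAdd m) x : algebraicClosure Fq Ks) : Ks))
    rw [Subtype.isCompact_iff]
    convert hC.isCompact.prod (isCompact_singleton (x := m)) using 1
    ext ⟨σ, n⟩
    constructor
    · rintro ⟨w, rfl, hw⟩
      obtain ⟨rfl, rfl⟩ := Prod.ext_iff.1 hw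
      exact ⟨w.2, rfl⟩
    · rintro ⟨hσ, rfl⟩
      exact ⟨⟨(σ, n), hσ⟩, rfl, rfl⟩

/-- The comparison for a totally disconnected Hausdorff group that is a disjoint union of compact
open subsets. -/
lemma HasCompactPartition.nonempty_canonicalComparison {G : Type u} [Group G] [TopologicalSpace G]
    [IsTopologicalGroup G] [T2Space G] [TotallyDisconnectedSpace G] (hG : HasCompactPartition G) :
    Nonempty (CanonicalComparison G) :=
  ⟨TopGModule.canonicalComparison (GSpace.projective_free_power hG)⟩

theorem corollary2p4 :
    (∀ (G : Type u) [Group G] [TopologicalSpace G] [IsTopologicalGroup G] [CompactSpace G]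
      [T2Space G] [TotallyDisconnectedSpace G], Nonempty (CanonicalComparison G)) ∧
    (∀ (Fq : Type w) (K : Type v) (Ks : Type u) [Field Fq] [Fintype Fq] [Field K] [Field Ks]
      [Algebra (RatFunc Fq) K] [FunctionField Fq K] [Algebra Fq K] [IsScalarTower Fq (RatFunc Fq) K]
      [Algebra K Ks] [IsSepClosure K Ks] [Algebra Fq Ks] [IsScalarTower Fq K Ks],
      Nonempty (CanonicalComparison (functionFieldWeilGroup Fq K Ks))) := by
  refine ⟨fun G => ?_, fun Fq K Ks => ?_⟩
  · intros
    exact (hasCompactPartition_of_compactSpace G).nonempty_canonicalComparison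
  · intros
    have : IsGalois K Ks := IsSepClosure.isGalois
    exact (hasCompactPartition_functionFieldWeilGroup Fq K Ks).nonempty_canonicalComparison
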